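/- All $C^*$-algebras are complex. For a commutative unital $C^*$-algebra $A$ let $A^{\mathrm{sa}}$ be its self-adjoint part, ordered by $x\ge 0\iff\exists a\in A:\ x=a^*a$. $A$ is a Rickart $C^*$-algebra if for every $x\in A$ there is a projection $P\in A$ with $\{y\in A\mid xy=0\}=PA$. A (real) Riesz space is a real vector lattice. A poset is countably additive complete if each nonempty countable subset that is bounded above has a supremum and each nonempty countable subset that is bounded below has an infimum. An f-algebra multiplication on a Riesz space is an associative bilinear multiplication such that $x,y\ge0\Rightarrow xy\ge0$, and $x\wedge y=0,\ z\ge 0\Rightarrow (xz)\wedge y=0$. A real MI-space is a real Banach lattice $X$ (a Riesz space with a complete norm such that $|x|\le|y|\Rightarrow\|x\|\le\|y\|$) with an order unit $e\ge0$ such that $\|x\|=\min\{\lambda\ge0\mid |x|\le\lambda e\}$ for all $x\in X$. A complex MI-space is a complex Banach space $X=Y\oplus iY$, where $Y=\mathrm{Re}(X)$ is a real subspace that is a Riesz space, such that every $x=x_1+ix_2$ ($x_1,x_2\in Y$) has a modulus $|x|=\sup_{t\in\mathbb R}(x_1\cos t+x_2\sin t)\in Y$, such that $|x|\le|y|\Rightarrow\|x\|\le\|y\|$,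 and with an order unit $0\le e\in Y$ such that $\|x\|=\min\{\lambda\ge0\mid|x|\le\lambda e\}$ for all $x\in X$. An abstract $L_\infty$ space is an MI-space $X$ such that $X$ (in the complex case: $\mathrm{Re}(X)$) is countably additive complete. Unit preserving Riesz homomorphisms are the linear maps (over $\mathbb R$, resp. $\mathbb C$) $f$ with $f(|x|)=|f(x)|$ and $f(e_1)=e_2$. The zero space and the zero algebra are admitted as objects. Let $\mathbf{MI}$ be the category of MI-spaces and unit preserving Riesz homomorphisms, $\mathbf{aL}_\infty$ its full subcategory of abstract $L_\infty$ spaces, $\mathbf{cC}^*_{\mathrm u}$ the category of commutative unital $C^*$-algebras and unital $*$-homomorphisms, and $\mathbf{cR}^*_{\mathrm u}$ its full subcategory of Rickart $C^*$-algebras. **Proposition.** Both for real MI-spaces and for complex MI-spaces, the categories $\mathbf{MI}$ and $\mathbf{cC}^*_{\mathrm u}$ are equivalent, and the categories $\mathbf{aL}_\infty$ and $\mathbf{cR}^*_{\mathrm u}$ are equivalent. More precisely, there are equivalences $E:\mathbf{MI}\to\mathbf{cC}^*_{\mathrm u}$ and $E':\mathbf{aL}_\infty\to\mathbf{cR}^*_{\mathrm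 u}$ such that 1. $E'$ is the restriction of $E$, up to natural isomorphism of functors $\mathbf{aL}_\infty\to\mathbf{cC}^*_{\mathrm u}$; 2. there are surjective linear isometries $\varphi_X$, natural in $X$, where $\varphi_X:X\to E(X)^{\mathrm{sa}}$ is real-linear in the real case, and $\varphi_X:X\to E(X)$ is complex-linear with $\varphi_X(\mathrm{Re}(X))=E(X)^{\mathrm{sa}}$ in the complex case, such that $\varphi_X(e)=1$; for $x$ in $X$ (resp. in $\mathrm{Re}(X)$), $x\ge0\iff\varphi_X(x)\ge0$; and the product of $E(X)$ corresponds under $\varphi_X$ to an f-algebra multiplication on $X$ (resp. on $\mathrm{Re}(X)$). -/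

import Mathlib

open CategoryTheory

universe u

/-! ### Order-theoretic notions -/

/-- A poset is countably additive complete if every nonempty countable subset that is bounded above
has a supremum, and every nonempty countable subset that is bounded below has an infimum. -/
def IsCountablyAdditiveComplete (Y : Type u) [PartialOrder Y] : Prop :=
  (∀ S : Set Y, S.Nonempty → S.Countable → BddAbove S → ∃ s, IsLUB S s) ∧
  (∀ S : Set Y, S.Nonempty → S.Countable → BddBelow S → ∃ s, IsGLB S s)

/-- The bilinear map `m` is an f-algebra multiplication on the Riesz space `Y`. -/
structure IsFAlgebraMul {Y : Type u} [Lattice Y] [AddCommGroup Y] [Module ℝ Y]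
    (m : Y →ₗ[ℝ] Y →ₗ[ℝ] Y) : Prop where
  assoc : ∀ x y z, m (m x y) z = m x (m y z)
  nonneg : ∀ x y, 0 ≤ x → 0 ≤ y → 0 ≤ m x y
  disjoint : ∀ x y z, x ⊓ y = 0 → 0 ≤ z → m x z ⊓ y = 0

/-! ### Real MI-spaces -/

/-- A real MI-space: a real Banach lattice whose norm is the order unit norm of an order unit. -/
structure RealMISpace : Type (u + 1) where
  carrier : Type u
  [normedAddCommGroup : NormedAddCommGroup carrier]
  [normedSpace : NormedSpace ℝ carrier]
  [lattice : Lattice carrier]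
  [isOrderedAddMonoid : IsOrderedAddMonoid carrier]
  [posSMulMono : PosSMulMono ℝ carrier]
  [hasSolidNorm : HasSolidNorm carrier]
  [completeSpace : CompleteSpace carrier]
  /-- the order unit -/
  unit : carrier
  unit_nonneg : 0 ≤ unit
  exists_abs_le : ∀ x : carrier, ∃ c : ℝ, 0 < c ∧ |x| ≤ c • unit
  isLeast_norm : ∀ x : carrier, IsLeast {c : ℝ | 0 ≤ c ∧ |x| ≤ c • unit} ‖x‖

namespace RealMISpace

instance : CoeSort RealMISpace.{u} (Type u) := ⟨carrier⟩

attribute [instance] normedAddCommGroup normedSpace lattice isOrderedAddMonoid posSMulMono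
  hasSolidNorm completeSpace

/-- Order unit preserving Riesz homomorphisms. -/
@[ext]
structure Hom (X Y : RealMISpace.{u}) : Type u where
  toLin : X →ₗ[ℝ] Y
  map_abs : ∀ x, toLin |x| = |toLin x|
  map_unit : toLin X.unit = Y.unit

instance : Category RealMISpace.{u} where
  Hom X Y := Hom X Y
  id X := ⟨LinearMap.id, fun _ => rfl, rfl⟩
  comp f g := ⟨g.toLin ∘ₗ f.toLin, fun x => by simp [f.map_abs, g.map_abs],
    by simp [f.map_unit, g.map_unit]⟩

/-- Abstract `L_∞` spaces among the real MI-spaces. -/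
def isAbstractLInfty : ObjectProperty RealMISpace.{u} := fun X => IsCountablyAdditiveComplete X

end RealMISpace

/-- The category of real abstract `L_∞` spaces and order unit preserving Riesz homomorphisms. -/
abbrev RealALInfty : Type (u + 1) := RealMISpace.isAbstractLInfty.{u}.FullSubcategory

/-! ### Complex MI-spaces -/

/-- A complex MI-space. The complex Banach space `carrier` is the direct sum of a real subspace
`real`, which is a Riesz space, and of `i` times `real`; each element has a modulus in `real`;
the norm is solid and complete and is the order unit norm of an order unit. The maps `re`, `im`,
`modulus` are determined by the remaining structure. -/
structure ComplexMISpace : Type (u + 1) where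
  carrier : Type u
  [normedAddCommGroup : NormedAddCommGroup carrier]
  [normedSpace : NormedSpace ℂ carrier]
  [completeSpace : CompleteSpace carrier]
  /-- the real part of the space -/
  real : Submodule ℝ carrier
  [lattice : Lattice real]
  [isOrderedAddMonoid : IsOrderedAddMonoid real]
  [posSMulMono : PosSMulMono ℝ real]
  re : carrier → real
  im : carrier → real
  re_add_im : ∀ x : carrier, (re x : carrier) + Complex.I • (im x : carrier) = x
  eq_zero_of_add_eq_zero :
    ∀ a b : real, (a : carrier) + Complex.I • (b : carrier) = 0 → a = 0 ∧ b = 0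
  modulus : carrier → real
  isLUB_modulus : ∀ x : carrier,
    IsLUB (Set.range fun t : ℝ => Real.cos t • re x + Real.sin t • im x) (modulus x)
  solid : ∀ x y : carrier, modulus x ≤ modulus y → ‖x‖ ≤ ‖y‖
  /-- the order unit -/
  unit : real
  unit_nonneg : 0 ≤ unit
  exists_modulus_le : ∀ x : carrier, ∃ c : ℝ, 0 < c ∧ modulus x ≤ c • unit
  isLeast_norm : ∀ x : carrier, IsLeast {c : ℝ | 0 ≤ c ∧ modulus x ≤ c • unit} ‖x‖

namespace ComplexMISpace

instance : CoeSort ComplexMISpace.{u} (Type u) := ⟨carrier⟩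

attribute [instance] normedAddCommGroup normedSpace completeSpace lattice isOrderedAddMonoid
  posSMulMono

/-- Order unit preserving complex Riesz homomorphisms: complex linear maps that commute with the
modulus (such a map sends the real part to the real part) and preserve the order unit. -/
@[ext]
structure Hom (X Y : ComplexMISpace.{u}) : Type u where
  toLin : X →ₗ[ℂ] Y
  map_modulus : ∀ x : X, toLin (X.modulus x : X) = (Y.modulus (toLin x) : Y)
  map_unit : toLin (X.unit : X) = (Y.unit : Y)

instance : Category ComplexMISpace.{u} where
  Hom X Y := Hom X Y
  id X := ⟨LinearMap.id, fun _ => rfl, rfl⟩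
  comp f g := ⟨g.toLin ∘ₗ f.toLin, fun x => by simp [f.map_modulus, g.map_modulus],
    by simp [f.map_unit, g.map_unit]⟩

/-- Abstract `L_∞` spaces among the complex MI-spaces. -/
def isAbstractLInfty : ObjectProperty ComplexMISpace.{u} :=
  fun X => IsCountablyAdditiveComplete X.real

end ComplexMISpace

/-- The category of complex abstract `L_∞` spaces and order unit preserving Riesz
homomorphisms. -/
abbrev ComplexALInfty : Type (u + 1) := ComplexMISpace.isAbstractLInfty.{u}.FullSubcategory

/-! ### Commutative C⋆-algebras -/

/-- Commutative unital (complex) C⋆-algebras. -/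
structure CommCStarAlgCat : Type (u + 1) where
  carrier : Type u
  [commCStarAlgebra : CommCStarAlgebra carrier]

namespace CommCStarAlgCat

instance : CoeSort CommCStarAlgCat.{u} (Type u) := ⟨carrier⟩

attribute [instance] commCStarAlgebra

/-- Unital ⋆-homomorphisms. -/
@[ext]
structure Hom (A B : CommCStarAlgCat.{u}) : Type u where
  toStarAlgHom : A →⋆ₐ[ℂ] B

instance : Category CommCStarAlgCat.{u} where
  Hom A B := Hom A B
  id A := ⟨StarAlgHom.id ℂ A⟩
  comp f g := ⟨g.toStarAlgHom.comp f.toStarAlgHom⟩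

/-- The Rickart condition: the right annihilator of each element is generated by a projection. -/
def isRickart : ObjectProperty CommCStarAlgCat.{u} := fun A =>
  ∀ x : A, ∃ p : A, IsStarProjection p ∧ {y : A | x * y = 0} = Set.range fun z : A => p * z

end CommCStarAlgCat

/-- The category of commutative unital Rickart C⋆-algebras and unital ⋆-homomorphisms. -/
abbrev CommRickartCat : Type (u + 1) := CommCStarAlgCat.isRickart.{u}.FullSubcategory

/-! ### The correspondence between the order structure and the algebraic structure -/

/-- The functor `F` sends each real MI-space `X` to a C⋆-algebra whose self-adjoint part is,
naturally in `X`, the space `X` itself: with the same norm, with the order given by the positive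
elements `a⋆ a`, with the order unit as multiplicative unit, and with an f-algebra multiplication
of `X` as product. -/
structure RealCorrespondence (F : RealMISpace.{u} ⥤ CommCStarAlgCat.{u}) where
  iso : ∀ X : RealMISpace.{u}, X ≃ₗᵢ[ℝ] selfAdjoint (F.obj X)
  iso_unit : ∀ X : RealMISpace.{u}, (iso X X.unit : F.obj X) = 1
  nonneg_iff : ∀ (X : RealMISpace.{u}) (x : X),
    0 ≤ x ↔ ∃ a : F.obj X, (iso X x : F.obj X) = star a * a
  mul : ∀ X : RealMISpace.{u}, X →ₗ[ℝ] X →ₗ[ℝ] X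
  isFAlgebraMul : ∀ X : RealMISpace.{u}, IsFAlgebraMul (mul X)
  iso_mul : ∀ (X : RealMISpace.{u}) (x y : X),
    (iso X (mul X x y) : F.obj X) = (iso X x : F.obj X) * (iso X y : F.obj X)
  naturality : ∀ {X Y : RealMISpace.{u}} (f : X ⟶ Y) (x : X),
    (iso Y (RealMISpace.Hom.toLin f x) : F.obj Y) =
      CommCStarAlgCat.Hom.toStarAlgHom (F.map f) (iso X x : F.obj X)

/-- The functor `F` sends each complex MI-space `X` to a C⋆-algebra which, naturally in `X`, is the
space `X` itself: with the same norm, with the real part of `X` as self-adjoint part, with the order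
given by the positive elements `a⋆ a`, with the order unit as multiplicative unit, and with the
product extending an f-algebra multiplication of the real part of `X`. -/
structure ComplexCorrespondence (F : ComplexMISpace.{u} ⥤ CommCStarAlgCat.{u}) where
  iso : ∀ X : ComplexMISpace.{u}, X ≃ₗᵢ[ℂ] F.obj X
  iso_unit : ∀ X : ComplexMISpace.{u}, iso X (X.unit : X) = 1
  mem_real_iff : ∀ (X : ComplexMISpace.{u}) (x : X), x ∈ X.real ↔ IsSelfAdjoint (iso X x)
  nonneg_iff : ∀ (X : ComplexMISpace.{u}) (x : X.real),
    0 ≤ x ↔ ∃ a : F.obj X, iso X (x : X) = star a * a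
  mul : ∀ X : ComplexMISpace.{u}, X.real →ₗ[ℝ] X.real →ₗ[ℝ] X.real
  isFAlgebraMul : ∀ X : ComplexMISpace.{u}, IsFAlgebraMul (mul X)
  iso_mul : ∀ (X : ComplexMISpace.{u}) (x y : X.real),
    iso X (mul X x y : X) = iso X (x : X) * iso X (y : X)
  naturality : ∀ {X Y : ComplexMISpace.{u}} (f : X ⟶ Y) (x : X),
    iso Y (ComplexMISpace.Hom.toLin f x) =
      CommCStarAlgCat.Hom.toStarAlgHom (F.map f) (iso X x)

set_option linter.unusedSectionVars false

/-! The self-adjoint part of a commutative C⋆-algebra is a real MI-space, and the algebra itself is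
a complex one: the Gelfand transform identifies the self-adjoint part with `C(Ω, ℝ)`, Ω the
character space, and all order notions are read off pointwise. This gives functors `toRealMISpace`
and `toComplexMISpace` on C⋆-algebras. The required `E` are quasi-inverses of these, so the work is
to show that both functors are fully faithful and essentially surjective.

Essential surjectivity in the real case is Kakutani's representation theorem (`eval_bijective`). A
maximal inf-closed cone avoiding `-e` defines a unital Riesz functional (`exists_rieszFunctional`);
there are enough of these to make evaluation isometric, and the lattice form of Stone–Weierstrass
makes it onto. Fullness rests on `rieszHom_saMul`: a unital Riesz homomorphism is multiplicative,
hence its complexification is a ⋆-homomorphism. The complex case reduces to the real one, because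
taking real parts is faithful on complex MI-spaces and isomorphisms of real parts extend.

For the second equivalence the two subcategories are matched on objects. Both the Rickart condition
and countable additive completeness say that every function in `C(Ω, ℝ)` has a support projection
(`HasSupportProjections`), which topologically means that closures of cozero sets are open. -/

/-! ### Unital Riesz functionals on a Riesz space with an order unit -/

section RieszFunctional

variable {X : Type u} [AddCommGroup X] [Module ℝ X] [Lattice X] [IsOrderedAddMonoid X]
  [PosSMulMono ℝ X]

/-- A convex cone that contains the positive cone, is closed under binary infima, and does not
contain `-e`. -/
structure IsProperInfCone (e : X) (P : Set X) : Prop where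
  mem_of_nonneg : ∀ x, 0 ≤ x → x ∈ P
  add_mem : ∀ x ∈ P, ∀ y ∈ P, x + y ∈ P
  smul_mem : ∀ c : ℝ, 0 ≤ c → ∀ x ∈ P, c • x ∈ P
  inf_mem : ∀ x ∈ P, ∀ y ∈ P, x ⊓ y ∈ P
  neg_unit_notMem : -e ∉ P

/-- The cone obtained from `P` by adjoining `-w`. -/
def adjoinNeg (P : Set X) (w : X) : Set X := {y | ∃ p ∈ P, ∃ t : ℝ, 0 ≤ t ∧ p - t • w ≤ y}

theorem IsProperInfCone.mem_of_le {e : X} {P : Set X} (hP : IsProperInfCone e P) {x y : X}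
    (hx : x ∈ P) (hxy : x ≤ y) : y ∈ P := by
  simpa using hP.add_mem x hx (y - x) (hP.mem_of_nonneg _ (sub_nonneg.2 hxy))

theorem neg_mem_adjoinNeg {P : Set X} (h0 : (0 : X) ∈ P) (w : X) : -w ∈ adjoinNeg P w :=
  ⟨0, h0, 1, zero_le_one, by simp⟩

theorem subset_adjoinNeg (P : Set X) (w : X) : P ⊆ adjoinNeg P w :=
  fun y hy => ⟨y, hy, 0, le_rfl, by simp⟩

/-- For infima the larger of the two coefficients serves both elements, since `w ≥ 0`. Properness of
the enlarged cone is the only condition that adjoining `-w` can destroy. -/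
theorem isProperInfCone_adjoinNeg {e : X} {P : Set X} {w : X} (hw : 0 ≤ w)
    (nonneg : ∀ x, 0 ≤ x → x ∈ P) (add : ∀ x ∈ P, ∀ y ∈ P, x + y ∈ P)
    (smul : ∀ c : ℝ, 0 ≤ c → ∀ x ∈ P, c • x ∈ P) (inf : ∀ x ∈ P, ∀ y ∈ P, x ⊓ y ∈ P)
    (h : -e ∉ adjoinNeg P w) : IsProperInfCone e (adjoinNeg P w) where
  mem_of_nonneg x hx := subset_adjoinNeg P w (nonneg x hx)
  add_mem := by
    rintro x ⟨p, hp, t, ht, hx⟩ y ⟨q, hq, s, hs, hy⟩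
    refine ⟨p + q, add _ hp _ hq, t + s, add_nonneg ht hs, ?_⟩
    calc p + q - (t + s) • w = (p - t • w) + (q - s • w) := by rw [add_smul]; abel
      _ ≤ x + y := add_le_add hx hy
  smul_mem := by
    rintro c hc x ⟨p, hp, t, ht, hx⟩
    refine ⟨c • p, smul c hc _ hp, c * t, mul_nonneg hc ht, ?_⟩
    rw [mul_smul, ← smul_sub]
    exact smul_le_smul_of_nonneg_left hx hc
  inf_mem := by
    rintro x ⟨p, hp, t, ht, hx⟩ y ⟨q, hq, s, hs, hy⟩
    refine ⟨p ⊓ q, inf _ hp _ hq, max t s, le_max_of_le_left ht, le_inf ?_ ?_⟩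
    · exact (sub_le_sub inf_le_left (smul_le_smul_of_nonneg_right (le_max_left t s) hw)).trans hx
    · exact (sub_le_sub inf_le_right (smul_le_smul_of_nonneg_right (le_max_right t s) hw)).trans hy
  neg_unit_notMem := h

theorem IsProperInfCone.of_chain {e : X} {C : Set (Set X)} (hC : ∀ P ∈ C, IsProperInfCone e P)
    (hchain : IsChain (· ⊆ ·) C) (hne : C.Nonempty) : IsProperInfCone e (⋃₀ C) where
  mem_of_nonneg x hx := by
    obtain ⟨P, hP⟩ := hne
    exact ⟨P, hP, (hC P hP).mem_of_nonneg x hx⟩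
  add_mem := by
    rintro x ⟨P, hP, hx⟩ y ⟨Q, hQ, hy⟩
    rcases hchain.total hP hQ with h | h
    · exact ⟨Q, hQ, (hC Q hQ).add_mem x (h hx) y hy⟩
    · exact ⟨P, hP, (hC P hP).add_mem x hx y (h hy)⟩
  smul_mem := by
    rintro c hc x ⟨P, hP, hx⟩
    exact ⟨P, hP, (hC P hP).smul_mem c hc x hx⟩
  inf_mem := by
    rintro x ⟨P, hP, hx⟩ y ⟨Q, hQ, hy⟩
    rcases hchain.total hP hQ with h | h
    · exact ⟨Q, hQ, (hC Q hQ).inf_mem x (h hx) y hy⟩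
    · exact ⟨P, hP, (hC P hP).inf_mem x hx y (h hy)⟩
  neg_unit_notMem := by
    rintro ⟨P, hP, h⟩
    exact (hC P hP).neg_unit_notMem h

/-- An element which is at most positive multiples of two disjoint elements is not positive. -/
theorem le_zero_of_le_smul_of_inf_eq_zero {u v w : X} (huv : u ⊓ v = 0) {s t : ℝ} (hs : 0 ≤ s)
    (ht : 0 ≤ t) (hu : w ≤ s • u) (hv : w ≤ t • v) : w ≤ 0 := by
  have hu0 : 0 ≤ u := huv ▸ inf_le_left
  have hv0 : 0 ≤ v := huv ▸ inf_le_right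
  -- A common coefficient for both bounds; the summand 1 makes it strictly positive, hence
  -- invertible.
  have hr : 0 < s + t + 1 := by positivity
  have h1 : w ≤ (s + t + 1) • u :=
    hu.trans (smul_le_smul_of_nonneg_right (by linarith) hu0)
  have h2 : w ≤ (s + t + 1) • v :=
    hv.trans (smul_le_smul_of_nonneg_right (by linarith) hv0)
  have key : (s + t + 1)⁻¹ • w ≤ u ⊓ v := by
    refine le_inf ?_ ?_
    · simpa [smul_smul, inv_mul_cancel₀ hr.ne'] using
        smul_le_smul_of_nonneg_left h1 (inv_nonneg.2 hr.le)
    · simpa [smul_smul, inv_mul_cancel₀ hr.ne'] using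
        smul_le_smul_of_nonneg_left h2 (inv_nonneg.2 hr.le)
  rw [huv] at key
  simpa [smul_smul, mul_inv_cancel₀ hr.ne'] using smul_le_smul_of_nonneg_left key hr.le

/-- Zorn's lemma, starting from the positive cone with `-v⁻` adjoined. If that cone contained `-e`,
then `e`, and with it `v⁺`, would lie below a multiple of `v⁻`; disjointness of `v⁺` and `v⁻` would
force `v⁺ ≤ 0`. -/
theorem exists_maximal_isProperInfCone {e : X} (hunit : ∀ x : X, ∃ c : ℝ, 0 < c ∧ |x| ≤ c • e)
    {v : X} (hv : ¬ v ≤ 0) :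
    ∃ P : Set X, Maximal (IsProperInfCone e) P ∧ -v⁻ ∈ P := by
  have h0 : IsProperInfCone e (adjoinNeg {y : X | 0 ≤ y} v⁻) := by
    refine isProperInfCone_adjoinNeg (negPart_nonneg v) (fun _ h => h)
      (fun _ hx _ hy => add_nonneg hx hy) (fun _ hc _ hx => smul_nonneg hc hx)
      (fun _ hx _ hy => le_inf hx hy) ?_
    rintro ⟨p, hp, t, ht, h⟩
    apply hv
    obtain ⟨c, hc, hce⟩ := hunit v⁺
    have he : e ≤ t • v⁻ := by
      have h' : -(t • v⁻) ≤ -e := (by simpa [sub_eq_add_neg] using hp :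
        -(t • v⁻) ≤ p - t • v⁻).trans h
      exact neg_le_neg_iff.1 h'
    have h1 : v⁺ ≤ (c * t) • v⁻ := by
      rw [mul_smul]
      exact ((le_abs_self _).trans hce).trans (smul_le_smul_of_nonneg_left he hc.le)
    have := le_zero_of_le_smul_of_inf_eq_zero (posPart_inf_negPart_eq_zero v) zero_le_one
      (mul_nonneg hc.le ht) (by simp) h1
    exact (le_posPart v).trans this
  obtain ⟨P, hsub, hmax⟩ := zorn_subset_nonempty {P : Set X | IsProperInfCone e P}
    (fun C hC hchain hne => ⟨⋃₀ C, IsProperInfCone.of_chain hC hchain hne,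
      fun s hs => Set.subset_sUnion_of_mem hs⟩) _ h0
  exact ⟨P, hmax, hsub (neg_mem_adjoinNeg (le_refl (0 : X)) _)⟩

/-- A maximal proper inf-closed cone is prime. -/
theorem neg_negPart_mem_or_neg_posPart_mem {e : X} {P : Set X}
    (hP : Maximal (IsProperInfCone e) P) (z : X) : -z⁻ ∈ P ∨ -z⁺ ∈ P := by
  have hc := hP.prop
  have h0 : (0 : X) ∈ P := hc.mem_of_nonneg 0 le_rfl
  -- By maximality, adjoining `-w` must produce `-e`. Used for both `z⁻` and `z⁺`, this puts an
  -- element `e + p ⊓ q` below multiples of two disjoint elements, so `-e` dominates `p ⊓ q ∈ P`.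
  have step : ∀ w : X, 0 ≤ w → -w ∉ P → ∃ p ∈ P, ∃ t : ℝ, 0 ≤ t ∧ e + p ≤ t • w := by
    intro w hw hwP
    by_contra hcon
    have hprop : IsProperInfCone e (adjoinNeg P w) := by
      refine isProperInfCone_adjoinNeg hw hc.mem_of_nonneg hc.add_mem hc.smul_mem hc.inf_mem ?_
      rintro ⟨p, hp, t, ht, h⟩
      refine hcon ⟨p, hp, t, ht, ?_⟩
      have := add_le_add_left h (e + t • w)
      calc e + p = p - t • w + (e + t • w) := by abel
        _ ≤ -e + (e + t • w) := this
        _ = t • w := by abel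
    exact hwP (hP.le_of_ge hprop (subset_adjoinNeg P w) (neg_mem_adjoinNeg h0 w))
  by_contra! hcon
  obtain ⟨p, hp, t, ht, h1⟩ := step _ (negPart_nonneg z) hcon.1
  obtain ⟨q, hq, s, hs, h2⟩ := step _ (posPart_nonneg z) hcon.2
  have h3 : e + p ⊓ q ≤ 0 := by
    refine le_zero_of_le_smul_of_inf_eq_zero (posPart_inf_negPart_eq_zero z) hs ht ?_ ?_
    · exact (add_le_add_right inf_le_right e).trans h2
    · exact (add_le_add_right inf_le_left e).trans h1
  refine hc.neg_unit_notMem (hc.mem_of_le (hc.inf_mem p hp q hq) ?_)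
  rwa [le_neg_iff_add_nonpos_left]

/-- Through each element that is not `≤ 0`, there is a unital Riesz functional which is
nonnegative at it. -/
theorem exists_rieszFunctional {e : X} (he : 0 ≤ e)
    (hunit : ∀ x : X, ∃ c : ℝ, 0 < c ∧ |x| ≤ c • e) {v : X} (hv : ¬ v ≤ 0) :
    ∃ ω : X →ₗ[ℝ] ℝ, ω e = 1 ∧ (∀ x, ω |x| = |ω x|) ∧ 0 ≤ ω v := by
  obtain ⟨P, hP, hvP⟩ := exists_maximal_isProperInfCone hunit hv
  have hc := hP.prop
  have h0 : (0 : X) ∈ P := hc.mem_of_nonneg 0 le_rfl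
  have htot : ∀ z : X, z ∈ P ∨ -z ∈ P := fun z =>
    (neg_negPart_mem_or_neg_posPart_mem hP z).imp
      (fun h => hc.mem_of_le h (neg_le.1 (neg_le_negPart z)))
      (fun h => hc.mem_of_le h (neg_le_neg (le_posPart z)))
  have hneg : ∀ c : ℝ, 0 < c → -(c • e) ∉ P := by
    intro c hc0 h
    apply hc.neg_unit_notMem
    simpa [smul_smul, inv_mul_cancel₀ hc0.ne'] using
      hc.smul_mem c⁻¹ (inv_nonneg.2 hc0.le) _ h
  -- The cone plays the role of `{ω ≥ 0}`, so the value at `y` is the Dedekind cut of those `c` with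
  -- `y - c • e ∈ P`. Recording both sides of the cut makes values unique, and linearity follows by
  -- exhibiting a value.
  let IsVal : X → ℝ → Prop := fun y r =>
    (∀ c < r, y - c • e ∈ P) ∧ (∀ c, r < c → c • e - y ∈ P)
  have hle : ∀ {y r s}, IsVal y r → IsVal y s → r ≤ s := by
    intro y r s hr hs
    by_contra! hlt
    obtain ⟨c, hsc, hcr⟩ := exists_between hlt
    obtain ⟨d, hcd, hdr⟩ := exists_between hcr
    have := hc.add_mem _ (hs.2 c hsc) _ (hr.1 d hdr)
    apply hneg (d - c) (sub_pos.2 hcd)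
    convert this using 1
    rw [sub_smul]; abel
  have huniq : ∀ {y r s}, IsVal y r → IsVal y s → r = s := fun hr hs =>
    le_antisymm (hle hr hs) (hle hs hr)
  have hex : ∀ y, ∃ r, IsVal y r := by
    intro y
    obtain ⟨l, hl, hyl⟩ := hunit y
    set S : Set ℝ := {c | y - c • e ∈ P} with hS
    have hne : S.Nonempty := by
      refine ⟨-l, hc.mem_of_nonneg _ ?_⟩
      rw [neg_smul, sub_neg_eq_add]
      exact neg_le_iff_add_nonneg.1 ((neg_le.1 ((neg_le_abs y).trans hyl)))
    have hbdd : BddAbove S := by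
      refine ⟨l, fun c hcS => ?_⟩
      by_contra! hlt
      apply hneg (c - l) (sub_pos.2 hlt)
      refine hc.mem_of_le hcS ?_
      calc y - c • e ≤ l • e - c • e := sub_le_sub_right ((le_abs_self y).trans hyl) _
        _ = -((c - l) • e) := by rw [sub_smul]; abel
    refine ⟨sSup S, fun c hcS => ?_, fun c hcS => ?_⟩
    · obtain ⟨d, hdS, hcd⟩ := exists_lt_of_lt_csSup hne hcS
      exact hc.mem_of_le hdS (sub_le_sub_left (smul_le_smul_of_nonneg_right hcd.le he) _)
    · rcases htot (y - c • e) with h | h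
      · exact absurd (le_csSup hbdd h) (not_le.2 hcS)
      · simpa using h
  choose ω hω using hex
  have hadd : ∀ x y, ω (x + y) = ω x + ω y := by
    intro x y
    refine huniq (hω _) ⟨fun c hcl => ?_, fun c hcl => ?_⟩
    -- The slack between `c` and `ω x + ω y` is shared equally between the two summands.
    · have := hc.add_mem _ ((hω x).1 (ω x - (ω x + ω y - c) / 2) (by linarith)) _
        ((hω y).1 (ω y - (ω x + ω y - c) / 2) (by linarith))
      convert this using 1
      rw [sub_add_sub_comm, ← add_smul]; congr 2; ring
    · have := hc.add_mem _ ((hω x).2 (ω x + (c - (ω x + ω y)) / 2) (by linarith)) _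
        ((hω y).2 (ω y + (c - (ω x + ω y)) / 2) (by linarith))
      convert this using 1
      rw [sub_add_sub_comm, ← add_smul]; congr 2; ring
  have hzero : ω 0 = 0 := by simpa using hadd 0 0
  have hnegω : ∀ x, ω (-x) = -ω x := fun x => by
    have := hadd x (-x)
    rw [add_neg_cancel, hzero] at this
    linarith
  have hsmulpos : ∀ (a : ℝ), 0 < a → ∀ x, ω (a • x) = a * ω x := by
    intro a ha x
    refine huniq (hω _) ⟨fun c hcl => ?_, fun c hcl => ?_⟩
    · have := hc.smul_mem a ha.le _ ((hω x).1 (c / a) ((div_lt_iff₀' ha).2 hcl))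
      rwa [smul_sub, smul_smul, mul_div_cancel₀ _ ha.ne'] at this
    · have := hc.smul_mem a ha.le _ ((hω x).2 (c / a) ((lt_div_iff₀' ha).2 hcl))
      rwa [smul_sub, smul_smul, mul_div_cancel₀ _ ha.ne'] at this
  have hsmul : ∀ (a : ℝ) x, ω (a • x) = a * ω x := by
    intro a x
    rcases lt_trichotomy a 0 with ha | rfl | ha
    · have := hsmulpos (-a) (neg_pos.2 ha) x
      rw [neg_smul, hnegω] at this
      linarith
    · simp [hzero]
    · exact hsmulpos a ha x
  have hmem : ∀ y ∈ P, 0 ≤ ω y := by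
    intro y hy
    by_contra! hlt
    obtain ⟨c, hc1, hc2⟩ := exists_between hlt
    apply hneg (-c) (neg_pos.2 hc2)
    have := hc.add_mem _ hy _ ((hω y).2 c hc1)
    simpa using this
  have hnonneg : ∀ y, 0 ≤ y → 0 ≤ ω y := fun y hy => hmem y (hc.mem_of_nonneg y hy)
  have hunitω : ω e = 1 := by
    refine huniq (hω _) ⟨fun c hcl => ?_, fun c hcl => ?_⟩
    · apply hc.mem_of_nonneg
      have : e - c • e = (1 - c) • e := by rw [sub_smul, one_smul]
      rw [this]
      exact smul_nonneg (sub_nonneg.2 hcl.le) he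
    · apply hc.mem_of_nonneg
      have : c • e - e = (c - 1) • e := by rw [sub_smul, one_smul]
      rw [this]
      exact smul_nonneg (sub_nonneg.2 hcl.le) he
  have hpn : ∀ x, ω x = ω x⁺ - ω x⁻ := fun x => by
    have := hadd (x⁺) (-x⁻)
    rw [← sub_eq_add_neg, posPart_sub_negPart, hnegω] at this
    linarith
  have habs : ∀ x, ω |x| = ω x⁺ + ω x⁻ := fun x => by
    rw [← posPart_add_negPart, hadd]
  refine ⟨⟨⟨ω, hadd⟩, fun a x => by simpa using hsmul a x⟩, hunitω, fun x => ?_, ?_⟩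
  · change ω |x| = |ω x|
    rw [habs, hpn x]
    have hp := hnonneg _ (posPart_nonneg x)
    have hn := hnonneg _ (negPart_nonneg x)
    -- Primeness of the cone makes `ω` vanish on `x⁺` or on `x⁻`, which is what compatibility with
    -- the modulus requires.
    rcases neg_negPart_mem_or_neg_posPart_mem hP x with h | h
    · have h1 := hmem _ h
      rw [hnegω] at h1
      have h2 : ω x⁻ = 0 := by linarith
      simp [h2, abs_of_nonneg hp]
    · have h1 := hmem _ h
      rw [hnegω] at h1
      have h2 : ω x⁺ = 0 := by linarith
      simp [h2, abs_of_nonneg hn]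
  · exact hmem v (hc.mem_of_le hvP (neg_le.1 (neg_le_negPart v)))

end RieszFunctional

/-! ### Kakutani representation of real MI-spaces. -/

namespace RealMISpace

theorem abs_le_norm_smul_unit (X : RealMISpace.{u}) (x : X) : |x| ≤ ‖x‖ • X.unit :=
  (X.isLeast_norm x).1.2

/-- The unital Riesz functionals on a real MI-space, as a set of functions. -/
def spectrum (X : RealMISpace.{u}) : Set (X → ℝ) :=
  {ω | (∀ x y, ω (x + y) = ω x + ω y) ∧ (∀ (c : ℝ) x, ω (c • x) = c * ω x) ∧
    (∀ x, ω |x| = |ω x|) ∧ ω X.unit = 1}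

theorem abs_apply_le_norm {X : RealMISpace.{u}} {ω : X → ℝ} (hω : ω ∈ X.spectrum) (x : X) :
    |ω x| ≤ ‖x‖ := by
  obtain ⟨hadd, hsmul, habs, hu⟩ := hω
  have h0 : 0 ≤ ‖x‖ • X.unit - |x| := sub_nonneg.2 (X.abs_le_norm_smul_unit x)
  have h1 : 0 ≤ ω (‖x‖ • X.unit - |x|) := by
    rw [← abs_of_nonneg h0, habs]; exact abs_nonneg _
  have h2 := hadd (‖x‖ • X.unit - |x|) |x|
  rw [sub_add_cancel, hsmul, hu, habs] at h2
  linarith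

/-- As in Banach–Alaoglu: the defining identities are closed conditions for pointwise convergence,
and the functionals lie in a product of the compact intervals `[-‖x‖, ‖x‖]`. -/
theorem isCompact_spectrum (X : RealMISpace.{u}) : IsCompact X.spectrum := by
  refine (isCompact_univ_pi fun x : X => isCompact_Icc (a := -‖x‖) (b := ‖x‖)).of_isClosed_subset
    ?_ fun ω hω x _ => abs_le.1 (abs_apply_le_norm hω x)
  simp only [spectrum, Set.ofPred_and, Set.ofPred_forall]
  refine IsClosed.inter ?_ (IsClosed.inter ?_ (IsClosed.inter ?_ ?_))
  · exact isClosed_iInter fun x => isClosed_iInter fun y =>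
      isClosed_eq (by fun_prop) (by fun_prop)
  · exact isClosed_iInter fun x => isClosed_iInter fun y =>
      isClosed_eq (by fun_prop) (by fun_prop)
  · exact isClosed_iInter fun x => isClosed_eq (by fun_prop) (by fun_prop)
  · exact isClosed_eq (by fun_prop) (by fun_prop)

instance (X : RealMISpace.{u}) : CompactSpace X.spectrum :=
  isCompact_iff_compactSpace.1 X.isCompact_spectrum

/-- Evaluation of unital Riesz functionals. -/
def eval (X : RealMISpace.{u}) : X →ₗ[ℝ] C(X.spectrum, ℝ) where
  toFun x := ⟨fun ω => ω.1 x, (continuous_apply x).comp continuous_subtype_val⟩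
  map_add' x y := by ext ω; exact ω.2.1 x y
  map_smul' c x := by ext ω; exact ω.2.2.1 c x

@[simp]
theorem eval_apply (X : RealMISpace.{u}) (x : X) (ω : X.spectrum) : X.eval x ω = ω.1 x := rfl

theorem eval_abs (X : RealMISpace.{u}) (x : X) : X.eval |x| = |X.eval x| := by
  ext ω
  rw [eval_apply, ω.2.2.2.1, ContinuousMap.abs_apply, eval_apply]

theorem eval_unit (X : RealMISpace.{u}) : X.eval X.unit = 1 := by
  ext ω
  exact ω.2.2.2.2

theorem norm_eval (X : RealMISpace.{u}) (x : X) : ‖X.eval x‖ = ‖x‖ := by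
  refine le_antisymm ((ContinuousMap.norm_le _ (norm_nonneg x)).2 fun ω => ?_) ?_
  · exact abs_apply_le_norm ω.2 x
  · by_contra! hlt
    obtain ⟨c, hc, hcx⟩ := exists_between hlt
    -- As `‖x‖` is the least admissible coefficient, `c` is not admissible; a functional that is
    -- nonnegative at `|x| - c • e` then satisfies `|ω x| ≥ c`.
    have hv : ¬ (|x| - c • X.unit ≤ 0) := fun h =>
      not_le.2 hcx ((X.isLeast_norm x).2 ⟨(norm_nonneg _).trans hc.le, sub_nonpos.1 h⟩)
    obtain ⟨ω, hu, habs, hpos⟩ := exists_rieszFunctional X.unit_nonneg X.exists_abs_le hv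
    have hω : (ω : X → ℝ) ∈ X.spectrum :=
      ⟨map_add ω, fun c x => by simp, habs, hu⟩
    have h1 := (X.eval x).norm_coe_le_norm ⟨ω, hω⟩
    rw [map_sub, map_smul, hu, habs] at hpos
    simp only [smul_eq_mul, mul_one, sub_nonneg] at hpos
    exact absurd (hc.trans_le (hpos.trans h1)) (lt_irrefl _)

/-- **Kakutani's theorem**: a real MI-space is the space of continuous functions on its
spectrum. -/
theorem eval_bijective (X : RealMISpace.{u}) : Function.Bijective X.eval := by
  let J : X →ₗᵢ[ℝ] C(X.spectrum, ℝ) := ⟨X.eval, X.norm_eval⟩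
  refine ⟨J.injective, Set.range_eq_univ.1 ?_⟩
  have hclosed : IsClosed (Set.range X.eval) := J.isometry.isClosedEmbedding.isClosed_range
  rw [← hclosed.closure_eq, ← Set.top_eq_univ]
  -- Lattice form of Stone–Weierstrass: a nonempty sublattice that interpolates arbitrary values at
  -- any two points is dense. The range is also closed, being an isometric image of a complete
  -- space.
  refine ContinuousMap.sublattice_closure_eq_top _ ⟨_, X.unit, rfl⟩ ?_ ?_ ?_
  · rintro _ ⟨x, rfl⟩ _ ⟨y, rfl⟩
    refine ⟨(2⁻¹ : ℝ) • (x + y - |y - x|), ?_⟩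
    rw [inf_eq_half_smul_add_sub_abs_sub ℝ, map_smul, map_sub, map_add, eval_abs, map_sub]
    simp
  · rintro _ ⟨x, rfl⟩ _ ⟨y, rfl⟩
    refine ⟨(2⁻¹ : ℝ) • (x + y + |y - x|), ?_⟩
    rw [sup_eq_half_smul_add_add_abs_sub ℝ, map_smul, map_add, map_add, eval_abs, map_sub]
    simp
  · intro v ω ψ
    by_cases h : ω = ψ
    · subst h
      exact ⟨_, ⟨v ω • X.unit, rfl⟩, by simp [eval_unit], by simp [eval_unit]⟩
    · have : ∃ x, ω.1 x ≠ ψ.1 x := by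
        by_contra! hcon
        exact h (Subtype.ext (funext hcon))
      obtain ⟨x, hx⟩ := this
      have hx' : ω.1 x - ψ.1 x ≠ 0 := sub_ne_zero.2 hx
      -- The affine combination of `x` and the unit that takes the value `v ω` at `ω` and `v ψ` at
      -- `ψ`.
      refine ⟨_, ⟨((v ω - v ψ) / (ω.1 x - ψ.1 x)) • (x - ψ.1 x • X.unit) + v ψ • X.unit, rfl⟩,
        ?_, ?_⟩
      · simp [eval_unit, div_mul_cancel₀ _ hx']
      · simp [eval_unit]

end RealMISpace

/-! ### The Riesz space of self-adjoint elements of a commutative C⋆-algebra -/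

namespace CommCStarAlgCat

open WeakDual

section SelfAdjoint

variable (A : Type u) [CommCStarAlgebra A]

/-- The real subspace of self-adjoint elements. -/
noncomputable abbrev saPart : Submodule ℝ A := selfAdjoint.submodule ℝ A

variable {A}

theorem isSelfAdjoint_coe (x : saPart A) : IsSelfAdjoint (x : A) := x.2

theorem ofReal_re_apply (x : saPart A) (φ : characterSpace ℂ A) :
    (((φ (x : A)).re : ℝ) : ℂ) = φ (x : A) := by
  have h : star (φ (x : A)) = φ (x : A) := by
    rw [← map_star, (isSelfAdjoint_coe x).star_eq]
  exact Complex.conj_eq_iff_re.1 h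

/-- The Gelfand transform of self-adjoint elements. -/
noncomputable def gelfandReal : saPart A →ₗ[ℝ] C(characterSpace ℂ A, ℝ) where
  toFun x := ⟨fun φ => (gelfandStarTransform A (x : A) φ).re, by fun_prop⟩
  map_add' x y := by ext φ; simp
  map_smul' c x := by
    ext φ
    have h : ((c • x : saPart A) : A) = (c : ℂ) • (x : A) := by simp
    change (φ ((c • x : saPart A) : A)).re = c * (φ (x : A)).re
    rw [h, map_smul, smul_eq_mul, Complex.re_ofReal_mul]

theorem ofReal_gelfandReal (x : saPart A) (φ : characterSpace ℂ A) :
    ((gelfandReal x φ : ℝ) : ℂ) = φ (x : A) := ofReal_re_apply x φ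

theorem ext_of_characters {a b : A} (h : ∀ φ : characterSpace ℂ A, φ a = φ b) : a = b :=
  (gelfandStarTransform A).injective (ContinuousMap.ext h)

theorem gelfandReal_injective : Function.Injective (gelfandReal (A := A)) := by
  intro x y h
  refine Subtype.ext (ext_of_characters fun φ => ?_)
  rw [← ofReal_gelfandReal, ← ofReal_gelfandReal, h]

theorem exists_apply_eq (f : C(characterSpace ℂ A, ℂ)) : ∃ a : A, ∀ φ : characterSpace ℂ A,
    φ a = f φ := by
  obtain ⟨a, ha⟩ := (gelfandStarTransform A).surjective f
  exact ⟨a, fun φ => by rw [← ha]; rfl⟩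

theorem gelfandReal_surjective : Function.Surjective (gelfandReal (A := A)) := by
  intro f
  obtain ⟨a, ha⟩ := exists_apply_eq (A := A) ⟨fun φ => ((f φ : ℝ) : ℂ), by fun_prop⟩
  have hsa : IsSelfAdjoint a := ext_of_characters fun φ => by
    rw [map_star, ha]; exact Complex.conj_ofReal _
  refine ⟨⟨a, hsa⟩, ContinuousMap.ext fun φ => ?_⟩
  apply Complex.ofReal_injective
  rw [ofReal_gelfandReal]
  exact ha φ

/-- The Gelfand transform, as an isomorphism of the self-adjoint part with the real continuous
functions. -/
noncomputable def gelfandRealEquiv : saPart A ≃ₗ[ℝ] C(characterSpace ℂ A, ℝ) :=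
  LinearEquiv.ofBijective gelfandReal ⟨gelfandReal_injective, gelfandReal_surjective⟩

@[simp]
theorem gelfandReal_symm (f : C(characterSpace ℂ A, ℝ)) :
    gelfandReal (gelfandRealEquiv.symm f) = f :=
  gelfandRealEquiv.apply_symm_apply f

noncomputable instance : Lattice (saPart A) where
  le x y := gelfandReal x ≤ gelfandReal y
  le_refl x := le_refl (gelfandReal x)
  le_trans x y z h h' := le_trans (a := gelfandReal x) h h'
  le_antisymm x y h h' := gelfandReal_injective (le_antisymm h h')
  sup x y := gelfandRealEquiv.symm (gelfandReal x ⊔ gelfandReal y)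
  inf x y := gelfandRealEquiv.symm (gelfandReal x ⊓ gelfandReal y)
  le_sup_left x y := by simp
  le_sup_right x y := by simp
  sup_le x y z h h' := by simpa using ⟨h, h'⟩
  inf_le_left x y := by simp
  inf_le_right x y := by simp
  le_inf x y z h h' := by simpa using ⟨h, h'⟩

theorem gelfandReal_le {x y : saPart A} : gelfandReal x ≤ gelfandReal y ↔ x ≤ y := Iff.rfl

theorem gelfandReal_sup (x y : saPart A) :
    gelfandReal (x ⊔ y) = gelfandReal x ⊔ gelfandReal y := gelfandReal_symm _

theorem gelfandReal_inf (x y : saPart A) :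
    gelfandReal (x ⊓ y) = gelfandReal x ⊓ gelfandReal y := gelfandReal_symm _

theorem gelfandReal_abs (x : saPart A) : gelfandReal |x| = |gelfandReal x| := by
  rw [abs, gelfandReal_sup, map_neg, abs]

instance : IsOrderedAddMonoid (saPart A) where
  add_le_add_left x y h z := by
    rw [← gelfandReal_le, map_add, map_add]
    exact add_le_add_left (gelfandReal_le.2 h) _

instance : PosSMulMono ℝ (saPart A) where
  smul_le_smul_of_nonneg_left c hc x y h := by
    rw [← gelfandReal_le, map_smul, map_smul]
    exact smul_le_smul_of_nonneg_left (gelfandReal_le.2 h) hc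

theorem le_iff_forall {x y : saPart A} : x ≤ y ↔ ∀ φ, gelfandReal x φ ≤ gelfandReal y φ := Iff.rfl

theorem nonneg_iff_forall {x : saPart A} : 0 ≤ x ↔ ∀ φ, 0 ≤ gelfandReal x φ := by
  rw [← gelfandReal_le, map_zero]
  rfl

/-- The order unit of the self-adjoint part. -/
noncomputable def saOne : saPart A := ⟨1, IsSelfAdjoint.one A⟩

@[simp]
theorem gelfandReal_saOne : gelfandReal (saOne : saPart A) = 1 := by
  ext φ
  apply Complex.ofReal_injective
  rw [ofReal_gelfandReal]
  simp [saOne]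

/-- The product of self-adjoint elements. -/
noncomputable def saMul : saPart A →ₗ[ℝ] saPart A →ₗ[ℝ] saPart A :=
  LinearMap.mk₂ ℝ (fun x y => ⟨(x : A) * y, (isSelfAdjoint_coe x).mul (isSelfAdjoint_coe y)⟩)
    (fun _ _ _ => Subtype.ext (add_mul _ _ _)) (fun _ _ _ => Subtype.ext (smul_mul_assoc _ _ _))
    (fun _ _ _ => Subtype.ext (mul_add _ _ _)) (fun _ _ _ => Subtype.ext (mul_smul_comm _ _ _))

@[simp]
theorem coe_saMul (x y : saPart A) : (saMul x y : A) = x * y := rfl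

@[simp]
theorem gelfandReal_saMul (x y : saPart A) :
    gelfandReal (saMul x y) = gelfandReal x * gelfandReal y := by
  ext φ
  apply Complex.ofReal_injective
  rw [ofReal_gelfandReal, ContinuousMap.mul_apply, Complex.ofReal_mul, ofReal_gelfandReal,
    ofReal_gelfandReal, coe_saMul, map_mul]

theorem isFAlgebraMul_saMul : IsFAlgebraMul (saMul (A := A)) where
  assoc x y z := Subtype.ext (mul_assoc _ _ _)
  nonneg x y hx hy := by
    rw [nonneg_iff_forall] at *
    intro φ
    simpa using mul_nonneg (hx φ) (hy φ)
  disjoint x y z h hz := by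
    apply gelfandReal_injective
    have h' := congrArg gelfandReal h
    rw [gelfandReal_inf] at h' ⊢
    rw [map_zero] at h' ⊢
    ext φ
    have h1 : gelfandReal x φ ⊓ gelfandReal y φ = 0 := DFunLike.congr_fun h' φ
    have h2 := nonneg_iff_forall.1 hz φ
    have hx : 0 ≤ gelfandReal x φ := h1 ▸ inf_le_left
    have hy : 0 ≤ gelfandReal y φ := h1 ▸ inf_le_right
    simp only [gelfandReal_saMul, ContinuousMap.inf_apply, ContinuousMap.mul_apply,
      ContinuousMap.zero_apply]
    rcases min_eq_iff.1 h1 with h3 | h3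
    · rw [h3.1, zero_mul]
      exact min_eq_left hy
    · rw [h3.1]
      exact min_eq_right (mul_nonneg hx h2)

theorem star_mul_self_apply (a : A) (φ : characterSpace ℂ A) :
    φ (star a * a) = ((‖φ a‖ ^ 2 : ℝ) : ℂ) := by
  rw [map_mul, map_star]
  simpa using Complex.conj_mul' (φ a)

/-- Reconciles the order pulled back along the Gelfand transform with the algebraic one; `a` is the
element whose transform is the pointwise square root. -/
theorem saPart_nonneg_iff (x : saPart A) : 0 ≤ x ↔ ∃ a : A, (x : A) = star a * a := by
  rw [nonneg_iff_forall]
  constructor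
  · intro h
    obtain ⟨a, ha⟩ := exists_apply_eq (A := A)
      ⟨fun φ => ((Real.sqrt (gelfandReal x φ) : ℝ) : ℂ), by fun_prop⟩
    refine ⟨a, ext_of_characters fun φ => ?_⟩
    rw [star_mul_self_apply, ha, ← ofReal_gelfandReal]
    simp [Complex.norm_real, Real.sq_sqrt (h φ)]
  · rintro ⟨a, ha⟩ φ
    have := ofReal_gelfandReal x φ
    rw [ha, star_mul_self_apply] at this
    rw [Complex.ofReal_injective this]
    positivity

/-- The modulus is the nonnegative square root of the square. This algebraic description lets moduli
in `C(K, ℂ)` be computed on `K`, without determining the characters of that algebra. -/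
theorem abs_eq_of_saMul_self_eq {x y : saPart A} (hy : 0 ≤ y) (h : saMul y y = saMul x x) :
    |x| = y := by
  apply gelfandReal_injective
  rw [gelfandReal_abs]
  ext φ
  have h' := DFunLike.congr_fun (congrArg gelfandReal h) φ
  simp only [gelfandReal_saMul, ContinuousMap.mul_apply] at h'
  have hy' := nonneg_iff_forall.1 hy φ
  rw [ContinuousMap.abs_apply, ← abs_of_nonneg hy']
  exact abs_eq_abs.2 (mul_self_eq_mul_self_iff.1 h'.symm)

theorem norm_le_iff (a : A) {c : ℝ} (hc : 0 ≤ c) :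
    ‖a‖ ≤ c ↔ ∀ φ : characterSpace ℂ A, ‖φ a‖ ≤ c := by
  have h : ‖gelfandStarTransform A a‖ = ‖a‖ :=
    (AddMonoidHomClass.isometry_iff_norm _).1 (gelfandTransform_isometry A) a
  rw [← h, ContinuousMap.norm_le _ hc]
  rfl

/-- The modulus of an element. -/
noncomputable def saModulus (a : A) : saPart A :=
  gelfandRealEquiv.symm ⟨fun φ => ‖gelfandStarTransform A a φ‖, by fun_prop⟩

@[simp]
theorem gelfandReal_saModulus (a : A) (φ : characterSpace ℂ A) :
    gelfandReal (saModulus a) φ = ‖φ a‖ := by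
  rw [saModulus, gelfandReal_symm]; rfl

theorem ofReal_gelfandReal_add_I_mul (a : A) (φ : characterSpace ℂ A) :
    (gelfandReal ⟨(realPart a : A), (realPart a).2⟩ φ : ℂ) +
      Complex.I * gelfandReal ⟨(imaginaryPart a : A), (imaginaryPart a).2⟩ φ = φ a := by
  rw [ofReal_gelfandReal, ofReal_gelfandReal, ← smul_eq_mul, ← map_smul, ← map_add]
  exact congrArg φ (realPart_add_I_smul_imaginaryPart a)

theorem gelfandReal_realPart (a : A) (φ : characterSpace ℂ A) :
    gelfandReal ⟨(realPart a : A), (realPart a).2⟩ φ = (φ a).re := by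
  rw [← ofReal_gelfandReal_add_I_mul]
  simp

theorem gelfandReal_imaginaryPart (a : A) (φ : characterSpace ℂ A) :
    gelfandReal ⟨(imaginaryPart a : A), (imaginaryPart a).2⟩ φ = (φ a).im := by
  rw [← ofReal_gelfandReal_add_I_mul]
  simp

theorem cos_mul_add_sin_mul_le (z : ℂ) (t : ℝ) :
    Real.cos t * z.re + Real.sin t * z.im ≤ ‖z‖ := by
  have h : Real.cos t * z.re + Real.sin t * z.im = (Complex.exp (-(t * Complex.I)) * z).re := by
    rw [← neg_mul, ← Complex.ofReal_neg, Complex.mul_re, Complex.exp_ofReal_mul_I_re,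
      Complex.exp_ofReal_mul_I_im]
    simp
  rw [h]
  refine (Complex.re_le_norm _).trans ?_
  rw [norm_mul, ← neg_mul, ← Complex.ofReal_neg, Complex.norm_exp_ofReal_mul_I, one_mul]

theorem cos_arg_mul_add_sin_arg_mul (z : ℂ) :
    Real.cos z.arg * z.re + Real.sin z.arg * z.im = ‖z‖ := by
  rcases eq_or_ne z 0 with rfl | hz
  · simp
  · have hz' : ‖z‖ ≠ 0 := norm_ne_zero_iff.2 hz
    rw [Complex.cos_arg hz, Complex.sin_arg]
    field_simp
    rw [Complex.sq_norm, Complex.normSq_apply]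
    ring

/-- At a character the family becomes the real part of `exp (-it) * φ a`, bounded by `‖φ a‖` and
attaining it at `t = arg (φ a)`. The optimal `t` depends on the character, but upper bounds may be
tested one character at a time. -/
theorem isLUB_saModulus (a : A) :
    IsLUB (Set.range fun t : ℝ => Real.cos t • (⟨(realPart a : A), (realPart a).2⟩ : saPart A) +
      Real.sin t • (⟨(imaginaryPart a : A), (imaginaryPart a).2⟩ : saPart A)) (saModulus a) := by
  constructor
  · rintro _ ⟨t, rfl⟩
    refine le_iff_forall.2 fun φ => ?_
    simp only [map_add, map_smul, ContinuousMap.add_apply, ContinuousMap.smul_apply,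
      gelfandReal_realPart, gelfandReal_imaginaryPart, gelfandReal_saModulus, smul_eq_mul]
    exact cos_mul_add_sin_mul_le _ _
  · intro b hb
    refine le_iff_forall.2 fun φ => ?_
    have h := le_iff_forall.1 (hb ⟨(φ a).arg, rfl⟩) φ
    simp only [map_add, map_smul, ContinuousMap.add_apply, ContinuousMap.smul_apply,
      gelfandReal_realPart, gelfandReal_imaginaryPart, smul_eq_mul] at h
    rw [gelfandReal_saModulus]
    rwa [cos_arg_mul_add_sin_arg_mul] at h

theorem saModulus_le_smul_saOne (a : A) (c : ℝ) :
    saModulus a ≤ c • saOne ↔ ∀ φ : characterSpace ℂ A, ‖φ a‖ ≤ c := by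
  rw [← gelfandReal_le, map_smul, gelfandReal_saOne]
  refine forall_congr' fun φ => ?_
  change gelfandReal (saModulus a) φ ≤ c * 1 ↔ _
  rw [gelfandReal_saModulus, mul_one]

theorem norm_apply_le (a : A) (φ : characterSpace ℂ A) : ‖φ a‖ ≤ ‖a‖ :=
  (norm_le_iff a (norm_nonneg a)).1 le_rfl φ

end SelfAdjoint

/-- A commutative C⋆-algebra as a complex MI-space. -/
noncomputable def toComplexMISpaceObj (A : CommCStarAlgCat.{u}) : ComplexMISpace.{u} where
  carrier := A
  real := saPart A
  re a := ⟨(realPart a : A), (realPart a).2⟩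
  im a := ⟨(imaginaryPart a : A), (imaginaryPart a).2⟩
  re_add_im a := realPart_add_I_smul_imaginaryPart a
  eq_zero_of_add_eq_zero a b h := by
    have h' : ∀ φ : characterSpace ℂ A,
        (gelfandReal a φ : ℂ) + Complex.I * gelfandReal b φ = 0 := fun φ => by
      rw [ofReal_gelfandReal, ofReal_gelfandReal, ← smul_eq_mul, ← map_smul, ← map_add, h, map_zero]
    constructor
    · apply gelfandReal_injective
      ext φ
      simpa using congrArg Complex.re (h' φ)
    · apply gelfandReal_injective
      ext φ
      simpa using congrArg Complex.im (h' φ)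
  modulus := saModulus
  isLUB_modulus := isLUB_saModulus
  solid x y h := by
    refine (norm_le_iff x (norm_nonneg y)).2 fun φ => ?_
    have h' := le_iff_forall.1 h φ
    rw [gelfandReal_saModulus, gelfandReal_saModulus] at h'
    exact h'.trans (norm_apply_le y φ)
  unit := saOne
  unit_nonneg := nonneg_iff_forall.2 fun φ => by simp
  exists_modulus_le a := ⟨‖a‖ + 1, by positivity, (saModulus_le_smul_saOne _ _).2 fun φ =>
    (norm_apply_le a φ).trans (by linarith)⟩
  isLeast_norm a := ⟨⟨norm_nonneg a, (saModulus_le_smul_saOne _ _).2 (norm_apply_le a)⟩,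
    fun c hc => (norm_le_iff a hc.1).2 ((saModulus_le_smul_saOne _ _).1 hc.2)⟩

/-- Characters of `B` pull back along `f` to characters of `A`, and the modulus is computed at
characters. -/
theorem saModulus_map {A B : CommCStarAlgCat.{u}} (f : A →⋆ₐ[ℂ] B) (a : A) :
    f (saModulus a : A) = (saModulus (f a) : B) := by
  refine ext_of_characters fun φ => ?_
  rw [← ofReal_gelfandReal, gelfandReal_saModulus]
  have := ofReal_gelfandReal (saModulus a) (CharacterSpace.compContinuousMap f φ)
  rw [gelfandReal_saModulus] at this
  exact this.symm

/-- The functor that regards a commutative C⋆-algebra as a complex MI-space. -/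
noncomputable def toComplexMISpace : CommCStarAlgCat.{u} ⥤ ComplexMISpace.{u} where
  obj := toComplexMISpaceObj
  map f := ⟨f.toStarAlgHom.toAlgHom.toLinearMap, saModulus_map f.toStarAlgHom,
    map_one f.toStarAlgHom⟩

end CommCStarAlgCat

/-! ### The real part of a complex MI-space -/

namespace ComplexMISpace

theorem eq_of_add_I_smul_eq (X : ComplexMISpace.{u}) {a b c d : X.real}
    (h : (a : X) + Complex.I • (b : X) = (c : X) + Complex.I • (d : X)) : a = c ∧ b = d := by
  have := X.eq_zero_of_add_eq_zero (a - c) (b - d) (by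
    rw [Submodule.coe_sub, Submodule.coe_sub, smul_sub, sub_add_sub_comm, h, sub_self])
  exact ⟨sub_eq_zero.1 this.1, sub_eq_zero.1 this.2⟩

theorem re_im_of_eq (X : ComplexMISpace.{u}) {x : X} {a b : X.real}
    (h : x = (a : X) + Complex.I • (b : X)) : X.re x = a ∧ X.im x = b :=
  X.eq_of_add_I_smul_eq ((X.re_add_im x).trans h)

theorem re_coe (X : ComplexMISpace.{u}) (a : X.real) : X.re (a : X) = a :=
  (X.re_im_of_eq (b := 0) (by simp)).1

theorem im_coe (X : ComplexMISpace.{u}) (a : X.real) : X.im (a : X) = 0 :=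
  (X.re_im_of_eq (a := a) (b := 0) (by simp)).2

theorem re_im_add (X : ComplexMISpace.{u}) (x y : X) :
    X.re (x + y) = X.re x + X.re y ∧ X.im (x + y) = X.im x + X.im y := by
  apply X.re_im_of_eq
  nth_rw 1 [← X.re_add_im x, ← X.re_add_im y]
  rw [Submodule.coe_add, Submodule.coe_add, smul_add]
  abel

theorem re_im_smul (X : ComplexMISpace.{u}) (z : ℂ) (x : X) :
    X.re (z • x) = z.re • X.re x - z.im • X.im x ∧
      X.im (z • x) = z.re • X.im x + z.im • X.re x := by
  apply X.re_im_of_eq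
  nth_rw 1 [← X.re_add_im x]
  simp only [Submodule.coe_sub, Submodule.coe_add, Submodule.coe_smul, ← Complex.coe_smul]
  match_scalars
  · nth_rw 1 [← Complex.re_add_im z]; ring
  · nth_rw 1 [← Complex.re_add_im z]
    linear_combination (z.im : ℂ) * Complex.I_mul_I

theorem modulus_coe (X : ComplexMISpace.{u}) (a : X.real) : X.modulus (a : X) = |a| := by
  refine (X.isLUB_modulus (a : X)).unique ?_
  simp only [re_coe, im_coe, smul_zero, add_zero]
  constructor
  · rintro _ ⟨t, rfl⟩
    calc Real.cos t • a ≤ |Real.cos t| • |a| := by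
          rcases le_total 0 (Real.cos t) with h | h
          · rw [abs_of_nonneg h]
            exact smul_le_smul_of_nonneg_left (le_abs_self a) h
          · rw [abs_of_nonpos h, ← neg_smul_neg]
            exact smul_le_smul_of_nonneg_left (neg_le_abs a) (neg_nonneg.2 h)
      _ ≤ (1 : ℝ) • |a| := smul_le_smul_of_nonneg_right (Real.abs_cos_le_one t) (abs_nonneg a)
      _ = |a| := one_smul _ _
  · intro b hb
    -- The parameters `t = 0` and `t = π` give `a` and `-a`.
    exact sup_le (by simpa using hb ⟨0, rfl⟩) (by simpa using hb ⟨Real.pi, rfl⟩)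

theorem abs_re_le_modulus (X : ComplexMISpace.{u}) (x : X) : |X.re x| ≤ X.modulus x :=
  sup_le (by simpa using (X.isLUB_modulus x).1 ⟨0, rfl⟩)
    (by simpa using (X.isLUB_modulus x).1 ⟨Real.pi, rfl⟩)

theorem norm_coe_re_le (X : ComplexMISpace.{u}) (x : X) : ‖(X.re x : X)‖ ≤ ‖x‖ :=
  X.solid _ _ (by rw [modulus_coe]; exact X.abs_re_le_modulus x)

/-- The real part is the fixed-point set of the norm-decreasing projection `re`; closedness supplies
its completeness as a real MI-space. -/
theorem isClosed_real (X : ComplexMISpace.{u}) : IsClosed (X.real : Set X) := by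
  let r : X →+ X := ⟨⟨fun x => (X.re x : X), congrArg Subtype.val (X.re_coe 0)⟩,
    fun x y => congrArg Subtype.val (X.re_im_add x y).1⟩
  have hr : Continuous r :=
    AddMonoidHomClass.continuous_of_bound r 1 fun x =>
      (X.norm_coe_re_le x).trans (one_mul ‖x‖).ge
  have : (X.real : Set X) = {x | r x = x} := by
    ext x
    refine ⟨fun hx => congrArg Subtype.val (X.re_coe ⟨x, hx⟩), fun hx => ?_⟩
    have h : r x = x := hx
    rw [← h]
    exact (X.re x).2
  rw [this]
  exact isClosed_eq hr continuous_id

/-- The real part of a complex MI-space. -/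
noncomputable def toRealMISpaceObj (X : ComplexMISpace.{u}) : RealMISpace.{u} where
  carrier := X.real
  hasSolidNorm := ⟨fun a b h => X.solid _ _ ((X.modulus_coe a).le.trans (h.trans (X.modulus_coe b).ge))⟩
  completeSpace := X.isClosed_real.completeSpace_coe
  unit := X.unit
  unit_nonneg := X.unit_nonneg
  exists_abs_le a := by simpa only [modulus_coe] using X.exists_modulus_le (a : X)
  isLeast_norm a := by
    have h := X.isLeast_norm (a : X)
    rw [modulus_coe] at h
    exact h

/-- A positive element is its own modulus, so its image is a modulus and therefore real; every real
element is a difference of positive ones. -/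
theorem map_mem_real {X Y : ComplexMISpace.{u}} (f : Hom X Y) (a : X.real) :
    f.toLin (a : X) ∈ Y.real := by
  have h : ∀ b : X.real, 0 ≤ b → f.toLin (b : X) ∈ Y.real := fun b hb => by
    have := f.map_modulus (b : X)
    rw [modulus_coe, abs_of_nonneg hb] at this
    rw [this]
    exact (Y.modulus _).2
  rw [← posPart_sub_negPart a, Submodule.coe_sub, map_sub]
  exact sub_mem (h _ (posPart_nonneg a)) (h _ (negPart_nonneg a))

/-- The restriction of a complex Riesz homomorphism to the real parts. -/
noncomputable def mapReal {X Y : ComplexMISpace.{u}} (f : Hom X Y) : X.real →ₗ[ℝ] Y.real :=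
  (f.toLin.restrictScalars ℝ).restrict fun a ha => map_mem_real f ⟨a, ha⟩

@[simp]
theorem coe_mapReal {X Y : ComplexMISpace.{u}} (f : Hom X Y) (a : X.real) :
    (mapReal f a : Y) = f.toLin (a : X) := rfl

/-- The functor that sends a complex MI-space to its real part. -/
noncomputable def toRealMISpace : ComplexMISpace.{u} ⥤ RealMISpace.{u} where
  obj := toRealMISpaceObj
  map {X Y} f := ⟨mapReal f, fun (a : X.real) => by
      have h := Hom.map_modulus f (a : X)
      rw [modulus_coe] at h
      refine Subtype.ext (h.trans ?_)
      rw [← coe_mapReal, modulus_coe]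
      rfl, Subtype.ext (Hom.map_unit f)⟩

/-- The complex linear extension of a real linear map between the real parts. -/
noncomputable def complexify {X Y : ComplexMISpace.{u}} (g : X.real →ₗ[ℝ] Y.real) : X →ₗ[ℂ] Y where
  toFun x := (g (X.re x) : Y) + Complex.I • (g (X.im x) : Y)
  map_add' x y := by
    rw [(X.re_im_add x y).1, (X.re_im_add x y).2]
    simp only [map_add, Submodule.coe_add, smul_add]
    abel
  map_smul' z x := by
    rw [(X.re_im_smul z x).1, (X.re_im_smul z x).2]
    simp only [map_add, map_sub, map_smul, Submodule.coe_add, Submodule.coe_sub, Submodule.coe_smul,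
      ← Complex.coe_smul, RingHom.id_apply]
    match_scalars
    · nth_rw 3 [← Complex.re_add_im z]; ring
    · nth_rw 3 [← Complex.re_add_im z]
      linear_combination -(z.im : ℂ) * Complex.I_mul_I

theorem complexify_apply {X Y : ComplexMISpace.{u}} (g : X.real →ₗ[ℝ] Y.real) (x : X) :
    complexify g x = (g (X.re x) : Y) + Complex.I • (g (X.im x) : Y) := rfl

@[simp]
theorem complexify_coe {X Y : ComplexMISpace.{u}} (g : X.real →ₗ[ℝ] Y.real) (a : X.real) :
    complexify g (a : X) = (g a : Y) := by
  rw [complexify_apply, re_coe, im_coe]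
  simp

theorem re_im_complexify {X Y : ComplexMISpace.{u}} (g : X.real →ₗ[ℝ] Y.real) (x : X) :
    Y.re (complexify g x) = g (X.re x) ∧ Y.im (complexify g x) = g (X.im x) :=
  Y.re_im_of_eq rfl

theorem linearMap_ext {X : ComplexMISpace.{u}} {V : Type*} [AddCommGroup V] [Module ℂ V]
    {f g : X →ₗ[ℂ] V} (h : ∀ a : X.real, f (a : X) = g (a : X)) : f = g := by
  ext x
  rw [← X.re_add_im x]
  simp [h]

instance : toRealMISpace.{u}.Faithful where
  map_injective {X Y f g} h := by
    refine Hom.ext (linearMap_ext fun a => ?_)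
    have := LinearMap.congr_fun (congrArg RealMISpace.Hom.toLin h) a
    exact congrArg Subtype.val this

end ComplexMISpace

/-! ### Homomorphisms and isomorphisms of real MI-spaces. -/

namespace RealMISpace

theorem comp_apply {X Y Z : RealMISpace.{u}} (f : X ⟶ Y) (g : Y ⟶ Z) (x : X) :
    Hom.toLin (f ≫ g) x = Hom.toLin g (Hom.toLin f x) := rfl

theorem id_apply {X : RealMISpace.{u}} (x : X) : Hom.toLin (𝟙 X) x = x := rfl

theorem Hom.monotone {X Y : RealMISpace.{u}} (f : Hom X Y) : Monotone f.toLin := by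
  intro x y h
  have h' : f.toLin (y - x) = |f.toLin (y - x)| := by
    rw [← f.map_abs, abs_of_nonneg (sub_nonneg.2 h)]
  rw [← sub_nonneg, ← map_sub, h']
  exact abs_nonneg _

/-- Positive unital maps carry order-unit bounds to order-unit bounds. Applied to an isomorphism and
its inverse, this yields an isometry. -/
theorem Hom.norm_le {X Y : RealMISpace.{u}} (f : Hom X Y) (x : X) : ‖f.toLin x‖ ≤ ‖x‖ := by
  refine (Y.isLeast_norm _).2 ⟨norm_nonneg x, ?_⟩
  rw [← f.map_abs, ← f.map_unit, ← map_smul]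
  exact f.monotone (X.abs_le_norm_smul_unit x)

section Iso

variable {X Y : RealMISpace.{u}} (i : X ≅ Y)

@[simp]
theorem inv_hom_apply (x : X) : Hom.toLin i.inv (Hom.toLin i.hom x) = x := by
  rw [← comp_apply, i.hom_inv_id, id_apply]

@[simp]
theorem hom_inv_apply (y : Y) : Hom.toLin i.hom (Hom.toLin i.inv y) = y := by
  rw [← comp_apply, i.inv_hom_id, id_apply]

/-- The linear isometry underlying an isomorphism of real MI-spaces. -/
def isoToLinearIsometryEquiv : X ≃ₗᵢ[ℝ] Y where
  toLinearEquiv :=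
    { Hom.toLin i.hom with
      invFun := Hom.toLin i.inv
      left_inv := inv_hom_apply i
      right_inv := hom_inv_apply i }
  norm_map' x := by
    refine le_antisymm (Hom.norm_le i.hom x) ?_
    have h := Hom.norm_le i.inv (Hom.toLin i.hom x)
    rwa [inv_hom_apply] at h

/-- The order isomorphism underlying an isomorphism of real MI-spaces. -/
def isoToOrderIso : X ≃o Y where
  toFun := Hom.toLin i.hom
  invFun := Hom.toLin i.inv
  left_inv := inv_hom_apply i
  right_inv := hom_inv_apply i
  map_rel_iff' {x y} := ⟨fun h => by simpa using Hom.monotone i.inv h,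
    fun h => Hom.monotone i.hom h⟩

end Iso

/-- A bijective unital Riesz homomorphism is an isomorphism. -/
noncomputable def isoOfBijective {X Y : RealMISpace.{u}} (f : Hom X Y)
    (hf : Function.Bijective f.toLin) : X ≅ Y where
  hom := f
  inv := ⟨(LinearEquiv.ofBijective f.toLin hf).symm.toLinearMap, fun y => by
      obtain ⟨x, rfl⟩ := hf.2 y
      apply hf.1
      simp [← f.map_abs],
    by
      apply hf.1
      simp [f.map_unit]⟩
  hom_inv_id := Hom.ext (LinearMap.ext fun x =>
    (LinearEquiv.ofBijective f.toLin hf).symm_apply_apply x)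
  inv_hom_id := Hom.ext (LinearMap.ext fun x =>
    (LinearEquiv.ofBijective f.toLin hf).apply_symm_apply x)

end RealMISpace

/-! ### Extending isomorphisms from the real parts. -/

namespace ComplexMISpace

/-- The complexification of an isomorphism between the real parts. -/
noncomputable def complexifyIsoHom {X Y : ComplexMISpace.{u}}
    (i : toRealMISpace.obj X ≅ toRealMISpace.obj Y) : X ⟶ Y where
  toLin := complexify (X := X) (Y := Y) (RealMISpace.Hom.toLin i.hom)
  map_modulus x := by
    let g : X.real →ₗ[ℝ] Y.real := RealMISpace.Hom.toLin i.hom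
    change complexify g _ = _
    rw [complexify_coe]
    -- The modulus is a supremum of an infinite family, preserved here because the monotone map has
    -- a monotone inverse.
    refine congrArg Subtype.val (IsLUB.unique ?_ (Y.isLUB_modulus (complexify g x)))
    rw [(re_im_complexify g x).1, (re_im_complexify g x).2]
    constructor
    · rintro _ ⟨t, rfl⟩
      simp only [← map_smul, ← map_add]
      exact RealMISpace.Hom.monotone i.hom ((X.isLUB_modulus x).1 ⟨t, rfl⟩)
    · intro b hb
      have h : X.modulus x ≤ RealMISpace.Hom.toLin i.inv b := by
        refine (X.isLUB_modulus x).2 ?_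
        rintro _ ⟨t, rfl⟩
        have h' := RealMISpace.Hom.monotone i.inv (hb ⟨t, rfl⟩)
        simp only [← map_smul, ← map_add] at h'
        exact (RealMISpace.inv_hom_apply i _).ge.trans h'
      exact (RealMISpace.Hom.monotone i.hom h).trans (RealMISpace.hom_inv_apply i b).le
  map_unit := (complexify_coe (X := X) (Y := Y) (RealMISpace.Hom.toLin i.hom) X.unit).trans
    (congrArg Subtype.val (RealMISpace.Hom.map_unit i.hom))

theorem map_complexifyIsoHom {X Y : ComplexMISpace.{u}}
    (i : toRealMISpace.obj X ≅ toRealMISpace.obj Y) :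
    toRealMISpace.map (complexifyIsoHom i) = i.hom :=
  RealMISpace.Hom.ext (LinearMap.ext fun a => Subtype.ext
    (complexify_coe (X := X) (Y := Y) (RealMISpace.Hom.toLin i.hom) a))

/-- An isomorphism between the real parts of complex MI-spaces extends to the spaces. -/
noncomputable def complexifyIso {X Y : ComplexMISpace.{u}}
    (i : toRealMISpace.obj X ≅ toRealMISpace.obj Y) : X ≅ Y where
  hom := complexifyIsoHom i
  inv := complexifyIsoHom i.symm
  hom_inv_id := toRealMISpace.map_injective (by simp [map_complexifyIsoHom])
  inv_hom_id := toRealMISpace.map_injective (by simp [map_complexifyIsoHom])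

end ComplexMISpace

/-! ### Commutative C⋆-algebras as MI-spaces -/

namespace CommCStarAlgCat

open WeakDual ComplexMISpace

/-! ### Multiplicativity of unital Riesz homomorphisms. -/

section RieszHom

variable {A : Type u} [CommCStarAlgebra A]

theorem rieszFunctional_mono {ω : saPart A →ₗ[ℝ] ℝ} (habs : ∀ x, ω |x| = |ω x|) {x y : saPart A}
    (h : x ≤ y) : ω x ≤ ω y := by
  have h' := habs (y - x)
  rw [abs_of_nonneg (sub_nonneg.2 h), map_sub] at h'
  linarith [abs_nonneg (ω y - ω x)]

/-- A unital Riesz functional on the self-adjoint part is multiplicative. -/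
theorem rieszFunctional_saMul {ω : saPart A →ₗ[ℝ] ℝ} (habs : ∀ x, ω |x| = |ω x|)
    (hone : ω saOne = 1) (x y : saPart A) : ω (saMul x y) = ω x * ω y := by
  -- The kernel is closed under squares because `|z²| ≤ ‖z‖ |z|`. Applied to `z - ω z • 1` this
  -- gives `ω (z²) = (ω z)²`, and polarization gives products.
  have hker : ∀ z : saPart A, ω z = 0 → ω (saMul z z) = 0 := by
    intro z hz
    have hle : |saMul z z| ≤ ‖(z : A)‖ • |z| := by
      refine le_iff_forall.2 fun φ => ?_
      have h1 : |gelfandReal z φ| ≤ ‖(z : A)‖ := by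
        rw [← Real.norm_eq_abs, ← Complex.norm_real, ofReal_gelfandReal]
        exact norm_apply_le _ φ
      rw [map_smul, gelfandReal_abs, gelfandReal_abs, gelfandReal_saMul]
      simp only [ContinuousMap.abs_apply, ContinuousMap.mul_apply, ContinuousMap.smul_apply,
        abs_mul, smul_eq_mul]
      exact mul_le_mul_of_nonneg_right h1 (abs_nonneg _)
    have h := rieszFunctional_mono habs hle
    rw [map_smul, habs, habs, hz, abs_zero, smul_zero] at h
    exact abs_eq_zero.1 (le_antisymm h (abs_nonneg _))
  have hone_mul : ∀ z : saPart A, saMul saOne z = z := fun z => Subtype.ext (one_mul _)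
  have hmul_one : ∀ z : saPart A, saMul z saOne = z := fun z => Subtype.ext (mul_one _)
  have hsq : ∀ z : saPart A, ω (saMul z z) = ω z * ω z := by
    intro z
    have h := hker (z - ω z • saOne) (by rw [map_sub, map_smul, hone]; simp)
    simp only [map_sub, map_smul, LinearMap.sub_apply, LinearMap.smul_apply, hone_mul, hmul_one,
      hone, smul_eq_mul] at h
    linarith
  have hcomm : saMul y x = saMul x y := Subtype.ext (mul_comm _ _)
  have h := hsq (x + y)
  simp only [map_add, LinearMap.add_apply, hcomm, hsq] at h
  linarith

variable {B : Type u} [CommCStarAlgebra B]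

/-- A unital Riesz homomorphism between self-adjoint parts is multiplicative. -/
theorem rieszHom_saMul {f : saPart A →ₗ[ℝ] saPart B} (habs : ∀ x, f |x| = |f x|)
    (hone : f saOne = saOne) (x y : saPart A) : f (saMul x y) = saMul (f x) (f y) := by
  apply gelfandReal_injective
  ext φ
  let ω : saPart A →ₗ[ℝ] ℝ :=
    { toFun := fun z => gelfandReal (f z) φ
      map_add' := fun x y => by simp
      map_smul' := fun c x => by simp }
  have h : ω (saMul x y) = ω x * ω y := by
    refine rieszFunctional_saMul (fun z => ?_) ?_ x y
    · change gelfandReal (f |z|) φ = |gelfandReal (f z) φ|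
      rw [habs, gelfandReal_abs, ContinuousMap.abs_apply]
    · change gelfandReal (f saOne) φ = 1
      rw [hone, gelfandReal_saOne, ContinuousMap.one_apply]
  rw [gelfandReal_saMul]
  exact h

end RieszHom

/-- The functor that sends a commutative C⋆-algebra to its self-adjoint part. -/
noncomputable def toRealMISpace : CommCStarAlgCat.{u} ⥤ RealMISpace.{u} :=
  toComplexMISpace ⋙ ComplexMISpace.toRealMISpace

/-- The unital ⋆-homomorphism that extends a unital Riesz homomorphism between the self-adjoint
parts. -/
noncomputable def starAlgHomOfRieszHom {A B : CommCStarAlgCat.{u}}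
    (f : saPart A →ₗ[ℝ] saPart B) (habs : ∀ x, f |x| = |f x|) (hone : f saOne = saOne) :
    A →⋆ₐ[ℂ] B :=
  let F : A →ₗ[ℂ] B :=
    complexify (X := toComplexMISpace.obj A) (Y := toComplexMISpace.obj B) f
  have hF : ∀ x : saPart A, F (x : A) = (f x : B) :=
    complexify_coe (X := toComplexMISpace.obj A) (Y := toComplexMISpace.obj B) f
  have hF1 : F 1 = 1 := (hF saOne).trans (congrArg Subtype.val hone)
  have hdecomp : ∀ a : A, ∃ x y : saPart A, (x : A) + Complex.I • (y : A) = a := fun a =>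
    ⟨_, _, (toComplexMISpaceObj A).re_add_im a⟩
  have hmul : ∀ x y : saPart A, F ((x : A) * y) = F x * F y := fun x y => by
    rw [← coe_saMul, hF, hF, hF, rieszHom_saMul habs hone, coe_saMul]
  { toFun := F
    map_one' := hF1
    map_mul' := fun a b => by
      obtain ⟨x, y, rfl⟩ := hdecomp a
      obtain ⟨z, w, rfl⟩ := hdecomp b
      simp only [add_mul, mul_add, smul_mul_assoc, mul_smul_comm, map_add, map_smul, hmul]
    map_zero' := map_zero F
    map_add' := map_add F
    commutes' := fun c => by
      rw [Algebra.algebraMap_eq_smul_one, map_smul, hF1, Algebra.algebraMap_eq_smul_one]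
    map_star' := fun a => by
      obtain ⟨x, y, rfl⟩ := hdecomp a
      simp only [star_add, star_smul, (isSelfAdjoint_coe _).star_eq, map_add, map_smul, hF] }

theorem starAlgHomOfRieszHom_coe {A B : CommCStarAlgCat.{u}}
    (f : saPart A →ₗ[ℝ] saPart B) (habs : ∀ x, f |x| = |f x|) (hone : f saOne = saOne)
    (x : saPart A) : starAlgHomOfRieszHom f habs hone (x : A) = (f x : B) :=
  complexify_coe (X := toComplexMISpace.obj A) (Y := toComplexMISpace.obj B) f x

instance : toComplexMISpace.{u}.Faithful where
  map_injective h :=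
    Hom.ext (StarAlgHom.ext fun a => LinearMap.congr_fun (congrArg ComplexMISpace.Hom.toLin h) a)

instance : toRealMISpace.{u}.Faithful :=
  inferInstanceAs (toComplexMISpace ⋙ ComplexMISpace.toRealMISpace).Faithful

instance : toRealMISpace.{u}.Full where
  map_surjective f :=
    ⟨⟨starAlgHomOfRieszHom (RealMISpace.Hom.toLin f) (RealMISpace.Hom.map_abs f)
        (RealMISpace.Hom.map_unit f)⟩,
      RealMISpace.Hom.ext (LinearMap.ext fun x => Subtype.ext
        (starAlgHomOfRieszHom_coe (RealMISpace.Hom.toLin f) (RealMISpace.Hom.map_abs f)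
          (RealMISpace.Hom.map_unit f) x))⟩

instance : toComplexMISpace.{u}.Full :=
  -- Fullness is inherited from the real case, since passing to real parts loses no morphisms.
  have : (toComplexMISpace ⋙ ComplexMISpace.toRealMISpace).Full :=
    inferInstanceAs toRealMISpace.Full
  Functor.Full.of_comp_faithful toComplexMISpace ComplexMISpace.toRealMISpace

/-! ### Real continuous functions inside the C⋆-algebra `C(K, ℂ)`. -/

section ContinuousMap

variable {K : Type u} [TopologicalSpace K] [CompactSpace K]

/-- Real continuous functions as self-adjoint elements of the C⋆-algebra of complex continuous
functions. -/
noncomputable def ofRealContinuousMap : C(K, ℝ) →ₗ[ℝ] saPart C(K, ℂ) where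
  toFun f := ⟨⟨fun k => (f k : ℂ), by fun_prop⟩, ContinuousMap.ext fun k => Complex.conj_ofReal _⟩
  map_add' f g := Subtype.ext (ContinuousMap.ext fun k => Complex.ofReal_add _ _)
  map_smul' c f := Subtype.ext (ContinuousMap.ext fun k => by simp)

theorem ofRealContinuousMap_apply (f : C(K, ℝ)) (k : K) :
    (ofRealContinuousMap f : C(K, ℂ)) k = (f k : ℂ) := rfl

theorem ofRealContinuousMap_bijective : Function.Bijective (ofRealContinuousMap (K := K)) := by
  constructor
  · intro f g h
    ext k
    exact Complex.ofReal_injective (DFunLike.congr_fun (congrArg Subtype.val h) k)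
  · intro x
    refine ⟨⟨fun k => ((x : C(K, ℂ)) k).re, by fun_prop⟩,
      Subtype.ext (ContinuousMap.ext fun k => ?_)⟩
    exact Complex.conj_eq_iff_re.1 (DFunLike.congr_fun (isSelfAdjoint_coe x).star_eq k)

theorem ofRealContinuousMap_nonneg {f : C(K, ℝ)} (hf : 0 ≤ f) : 0 ≤ ofRealContinuousMap f := by
  refine (saPart_nonneg_iff _).2 ⟨⟨fun k => (Real.sqrt (f k) : ℂ), by fun_prop⟩, ?_⟩
  ext k
  simp only [ofRealContinuousMap_apply, ContinuousMap.mul_apply, ContinuousMap.star_apply,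
    ContinuousMap.coe_mk, Complex.star_def, Complex.conj_ofReal, ← Complex.ofReal_mul]
  rw [Real.mul_self_sqrt (show 0 ≤ f k from hf k)]

theorem ofRealContinuousMap_abs (f : C(K, ℝ)) :
    ofRealContinuousMap |f| = |ofRealContinuousMap f| := by
  refine (abs_eq_of_saMul_self_eq (ofRealContinuousMap_nonneg (abs_nonneg f)) ?_).symm
  refine Subtype.ext (ContinuousMap.ext fun k => ?_)
  simp only [coe_saMul, ContinuousMap.mul_apply, ofRealContinuousMap_apply,
    ContinuousMap.abs_apply, ← Complex.ofReal_mul, abs_mul_abs_self]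

end ContinuousMap

/-- A real MI-space is the self-adjoint part of the C⋆-algebra of continuous functions on its
spectrum. -/
noncomputable def realMISpaceIso (X : RealMISpace.{u}) :
    X ≅ toRealMISpace.obj ⟨C(X.spectrum, ℂ)⟩ :=
  RealMISpace.isoOfBijective (Y := toRealMISpace.obj ⟨C(X.spectrum, ℂ)⟩)
    { toLin := (ofRealContinuousMap (K := X.spectrum)).comp X.eval
      map_abs := fun x => (congrArg ofRealContinuousMap (X.eval_abs x)).trans
        (ofRealContinuousMap_abs (X.eval x))
      map_unit := (congrArg ofRealContinuousMap X.eval_unit).trans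
        (Subtype.ext (ContinuousMap.ext fun _ => Complex.ofReal_one)) }
    (ofRealContinuousMap_bijective.comp X.eval_bijective)

instance : toRealMISpace.{u}.EssSurj where
  mem_essImage X := ⟨_, ⟨(realMISpaceIso X).symm⟩⟩

instance : toComplexMISpace.{u}.EssSurj where
  mem_essImage X :=
    ⟨_, ⟨complexifyIso (realMISpaceIso (ComplexMISpace.toRealMISpace.obj X)).symm⟩⟩

instance : toRealMISpace.{u}.IsEquivalence where

instance : toComplexMISpace.{u}.IsEquivalence where

end CommCStarAlgCat

/-! ### The Rickart condition and countable additive completeness -/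

theorem IsCountablyAdditiveComplete.of_orderIso {X Y : Type u} [PartialOrder X] [PartialOrder Y]
    (e : X ≃o Y) (h : IsCountablyAdditiveComplete X) : IsCountablyAdditiveComplete Y := by
  constructor
  · intro S hne hc hb
    obtain ⟨s, hs⟩ := h.1 (e.symm '' S) (hne.image _) (hc.image _) (e.symm.monotone.map_bddAbove hb)
    exact ⟨e s, by simpa using e.isLUB_image'.2 hs⟩
  · intro S hne hc hb
    obtain ⟨s, hs⟩ := h.2 (e.symm '' S) (hne.image _) (hc.image _) (e.symm.monotone.map_bddBelow hb)
    exact ⟨e s, by simpa using e.isGLB_image'.2 hs⟩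

/-- In a Riesz space the condition on infima follows from that on suprema. -/
theorem isCountablyAdditiveComplete_of_exists_isLUB {Y : Type u} [AddCommGroup Y] [PartialOrder Y]
    [IsOrderedAddMonoid Y]
    (h : ∀ S : Set Y, S.Nonempty → S.Countable → BddAbove S → ∃ s, IsLUB S s) :
    IsCountablyAdditiveComplete Y := by
  refine ⟨h, fun S hne hc hb => ?_⟩
  obtain ⟨s, hs⟩ := h (-S) hne.neg (by rw [← Set.image_neg_eq_neg]; exact hc.image _) hb.neg
  exact ⟨-s, isLUB_neg.1 hs⟩

/-- Each continuous function has a support projection. -/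
def HasSupportProjections (K : Type u) [TopologicalSpace K] : Prop :=
  ∀ g : C(K, ℝ), ∃ p : C(K, ℝ), p * p = p ∧ (∀ k, g k ≠ 0 → p k = 1) ∧
    ∀ y : C(K, ℝ), g * y = 0 → p * y = 0

/-! ### Support projections and countable suprema in `C(K, ℝ)`. -/

section ContinuousMap

variable {K : Type u} [TopologicalSpace K]

/-- The functions `(n • g) ⊓ 1` increase pointwise to the indicator of `{g > 0}`; `n = 0` accounts
for `0 ≤ u`. -/
theorem mem_upperBounds_range_nsmul_inf_one {g u : C(K, ℝ)} (hg : 0 ≤ g) :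
    u ∈ upperBounds (Set.range fun n : ℕ => (n • g) ⊓ 1) ↔
      ∀ k, 0 ≤ u k ∧ (0 < g k → 1 ≤ u k) := by
  constructor
  · intro hu k
    have h : ∀ n : ℕ, min (n * g k) 1 ≤ u k := fun n => by
      have := ContinuousMap.le_def.1 (hu ⟨n, rfl⟩) k
      simpa using this
    refine ⟨by simpa using h 0, fun hk => ?_⟩
    obtain ⟨n, hn⟩ := exists_nat_gt (1 / g k)
    have h1 : 1 ≤ n * g k := ((div_lt_iff₀ hk).1 hn).le
    simpa [min_eq_right h1] using h n
  · rintro hu _ ⟨n, rfl⟩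
    refine ContinuousMap.le_def.2 fun k => ?_
    have hk : 0 ≤ g k := hg k
    rcases hk.eq_or_lt with h0 | h0
    · simp [← h0, (hu k).1]
    · exact le_trans (by simp) ((hu k).2 h0)

/-- The projection is the supremum `p` of `(n • |g|) ⊓ 1`. Three competing upper bounds give its
properties: `1` yields `p ≤ 1`, `p * p` yields idempotence, and `1 - |y| ⊓ 1` yields `p < 1`, hence
`p = 0`, wherever `y ≠ 0`. -/
theorem hasSupportProjections_of_isCountablyAdditiveComplete
    (h : IsCountablyAdditiveComplete C(K, ℝ)) : HasSupportProjections K := by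
  intro g'
  set g := |g'| with hgdef
  have hg : 0 ≤ g := abs_nonneg g'
  have hgk : ∀ k, g k = |g' k| := fun k => rfl
  obtain ⟨p, hp⟩ := h.1 (Set.range fun n : ℕ => (n • g) ⊓ 1) (Set.range_nonempty _)
    (Set.countable_range _) ⟨1, (mem_upperBounds_range_nsmul_inf_one hg).2 fun k => by simp⟩
  have hle : ∀ u : C(K, ℝ), (∀ k, 0 ≤ u k ∧ (0 < g k → 1 ≤ u k)) → ∀ k, p k ≤ u k :=
    fun u hu => ContinuousMap.le_def.1 (hp.2 ((mem_upperBounds_range_nsmul_inf_one hg).2 hu))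
  have hub := (mem_upperBounds_range_nsmul_inf_one hg).1 hp.1
  have hp1 : ∀ k, p k ≤ 1 := hle 1 fun k => by simp
  have hpp : ∀ k, p k * p k = p k := fun k => le_antisymm
    (mul_le_of_le_one_left (hub k).1 (hp1 k))
    (hle (p * p) (fun k => ⟨mul_self_nonneg _, fun hk => by
      have := (hub k).2 hk
      simpa using one_le_mul_of_one_le_of_one_le this this⟩) k)
  refine ⟨p, ContinuousMap.ext hpp, fun k hk => ?_, fun y hy => ?_⟩
  · exact le_antisymm (hp1 k) ((hub k).2 (by rw [hgk]; exact abs_pos.2 hk))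
  · have hu := hle (1 - |y| ⊓ 1) fun k => by
      refine ⟨by simp, fun hk => ?_⟩
      have h0 : g' k * y k = 0 := DFunLike.congr_fun hy k
      rw [hgk, abs_pos] at hk
      simp [(mul_eq_zero.1 h0).resolve_left hk]
    ext k
    by_cases hyk : y k = 0
    · simp [hyk]
    · have hlt : p k < 1 := by
        refine (hu k).trans_lt ?_
        simp [hyk]
      have : p k * (p k - 1) = 0 := by rw [mul_sub, hpp, mul_one, sub_self]
      have hz := (mul_eq_zero.1 this).resolve_right (by linarith)
      simp [hz]

variable [CompactSpace K] [T2Space K]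

/-- If continuous functions have support projections, then closures of cozero sets are open. -/
theorem HasSupportProjections.isOpen_closure (h : HasSupportProjections K) (g : C(K, ℝ)) :
    IsOpen (closure {k | g k ≠ 0}) := by
  obtain ⟨p, -, hp1, hp2⟩ := h g
  have hcl : closure {k | g k ≠ 0} ⊆ {k | p k = 1} :=
    closure_minimal hp1 (isClosed_eq p.continuous continuous_const)
  have : closure {k | g k ≠ 0} = {k | p k ≠ 0} := by
    refine Set.Subset.antisymm (fun k hk => ?_) (fun k hk => ?_)
    · have : p k = 1 := hcl hk
      simp [this]
    · by_contra hkc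
      -- A Urysohn function annihilated by `g` detects that `p` vanishes at any point off the
      -- closure.
      obtain ⟨y, hy0, hy1, -⟩ := exists_continuous_zero_one_of_isClosed isClosed_closure
        (isClosed_singleton (x := k)) (Set.disjoint_singleton_right.2 hkc)
      have hgy : g * y = 0 := by
        ext l
        by_cases hl : g l = 0
        · simp [hl]
        · simp [hy0 (subset_closure (show l ∈ {k | g k ≠ 0} from hl))]
      have h0 : p k * y k = 0 := DFunLike.congr_fun (hp2 y hgy) k
      rw [hy1 rfl] at h0
      exact hk (by simpa using h0)
  rw [this]
  exact isOpen_ne_fun p.continuous continuous_const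

/-- A countable union of cozero sets is a cozero set: weight the truncated positive parts of `f n -
r` by `2⁻ⁿ` and sum. This is where countability enters. -/
theorem HasSupportProjections.isOpen_closure_iUnion (h : HasSupportProjections K)
    (f : ℕ → C(K, ℝ)) (r : ℝ) : IsOpen (closure {k | ∃ n, r < f n k}) := by
  let G : ℕ → K → ℝ := fun n k => (1 / 2) ^ n * min 1 (max 0 (f n k - r))
  have hG0 : ∀ n k, 0 ≤ G n k := fun n k => by positivity
  have hGle : ∀ n k, G n k ≤ (1 / 2) ^ n := fun n k =>
    mul_le_of_le_one_right (by positivity) (min_le_left _ _)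
  have hsum : Summable fun n : ℕ => ((1 / 2 : ℝ)) ^ n := summable_geometric_two
  have hGsum : ∀ k, Summable fun n => G n k := fun k =>
    Summable.of_nonneg_of_le (fun n => hG0 n k) (fun n => hGle n k) hsum
  let g : C(K, ℝ) := ⟨fun k => ∑' n, G n k, continuous_tsum (fun n => by fun_prop) hsum
    fun n k => by rw [Real.norm_of_nonneg (hG0 n k)]; exact hGle n k⟩
  convert h.isOpen_closure g using 2
  ext k
  constructor
  · rintro ⟨n, hn⟩
    refine ((hGsum k).tsum_pos (fun n => hG0 n k) n ?_).ne'
    have : 0 < f n k - r := sub_pos.2 hn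
    positivity
  · intro hk
    by_contra hcon
    apply hk
    change ∑' n, G n k = 0
    have : ∀ n, G n k = 0 := fun n => by
      have hn : f n k ≤ r := not_lt.1 fun hn => hcon ⟨n, hn⟩
      simp [G, max_eq_left (sub_nonpos.2 hn)]
    simp [this]

/-- The pointwise supremum need not be continuous, so it is rebuilt from the clopen sets `U r`, the
closures of its strict superlevel sets: `s k` is the supremum of the `r` with `k ∈ U r`. Openness of
`U r` gives lower semicontinuity and closedness gives upper semicontinuity. A continuous upper bound
is at least `r` on all of `U r`, so `s` is least. -/
theorem HasSupportProjections.isCountablyAdditiveComplete (h : HasSupportProjections K) :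
    IsCountablyAdditiveComplete C(K, ℝ) := by
  refine isCountablyAdditiveComplete_of_exists_isLUB fun S hne hc ⟨b, hb⟩ => ?_
  obtain ⟨f, rfl⟩ := hc.exists_eq_range hne
  let U : ℝ → Set K := fun r => closure {k | ∃ n, r < f n k}
  have hUo : ∀ r, IsOpen (U r) := h.isOpen_closure_iUnion f
  have hUanti : ∀ {r r'}, r ≤ r' → U r' ⊆ U r := fun hr =>
    closure_mono fun k ⟨n, hn⟩ => ⟨n, hr.trans_lt hn⟩
  have hUle : ∀ u : C(K, ℝ), u ∈ upperBounds (Set.range f) → ∀ k r, k ∈ U r → r ≤ u k := by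
    intro u hu k r hk
    have : U r ⊆ {k | r ≤ u k} :=
      closure_minimal (fun l ⟨n, hn⟩ => hn.le.trans (ContinuousMap.le_def.1 (hu ⟨n, rfl⟩) l))
        (isClosed_le continuous_const u.continuous)
    exact this hk
  have hmem : ∀ {n k r}, r < f n k → k ∈ U r := fun hr => subset_closure ⟨_, hr⟩
  have hUne : ∀ k, {r | k ∈ U r}.Nonempty := fun k => ⟨f 0 k - 1, hmem (n := 0) (by linarith)⟩
  have hUbdd : ∀ k, BddAbove {r | k ∈ U r} := fun k => ⟨b k, fun r hr => hUle b hb k r hr⟩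
  let s : K → ℝ := fun k => sSup {r | k ∈ U r}
  have hs : Continuous s := by
    refine OrderTopology.continuous_iff.2 fun a => ⟨?_, ?_⟩
    · have : s ⁻¹' Set.Ioi a = ⋃ r > a, U r := by
        ext k
        simp only [Set.mem_preimage, Set.mem_Ioi, Set.mem_iUnion, exists_prop]
        constructor
        · intro hk
          obtain ⟨r, hr, har⟩ := exists_lt_of_lt_csSup (hUne k) hk
          exact ⟨r, har, hr⟩
        · rintro ⟨r, har, hr⟩
          exact lt_of_lt_of_le har (le_csSup (hUbdd k) hr)
      rw [this]
      exact isOpen_biUnion fun r _ => hUo r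
    · have : s ⁻¹' Set.Iio a = ⋃ r < a, (U r)ᶜ := by
        ext k
        simp only [Set.mem_preimage, Set.mem_Iio, Set.mem_iUnion, exists_prop, Set.mem_compl_iff]
        constructor
        · intro hk
          obtain ⟨r, hkr, hra⟩ := exists_between hk
          exact ⟨r, hra, fun hr => not_le.2 hkr (le_csSup (hUbdd k) hr)⟩
        · rintro ⟨r, hra, hr⟩
          refine lt_of_le_of_lt (csSup_le (hUne k) fun r' hr' => ?_) hra
          by_contra! hlt
          exact hr (hUanti hlt.le hr')
      rw [this]
      exact isOpen_biUnion fun r _ => isClosed_closure.isOpen_compl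
  refine ⟨⟨s, hs⟩, ?_, fun u hu => ContinuousMap.le_def.2 fun k => ?_⟩
  · rintro _ ⟨n, rfl⟩
    refine ContinuousMap.le_def.2 fun k => le_of_forall_lt fun r hr => ?_
    obtain ⟨r', hr', hr''⟩ := exists_between hr
    exact hr'.trans_le (le_csSup (hUbdd k) (hmem hr''))
  · exact csSup_le (hUne k) fun r hr => hUle u hu k r hr

end ContinuousMap

/-! ### The Rickart condition on the character space. -/

namespace CommCStarAlgCat

open WeakDual

/-- The support projection of an element and the projection generating its annihilator are
complementary, `p = 1 - q`. -/
theorem isRickart_iff_hasSupportProjections (A : CommCStarAlgCat.{u}) :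
    isRickart A ↔ HasSupportProjections (characterSpace ℂ A) := by
  constructor
  · intro h g
    obtain ⟨x, rfl⟩ := gelfandReal_surjective g
    obtain ⟨q, hq, hann⟩ := h (x : A)
    let Q : saPart A := ⟨q, hq.isSelfAdjoint⟩
    have hQQ : saMul Q Q = Q := Subtype.ext hq.isIdempotentElem
    have hQQ' := congrArg gelfandReal hQQ
    rw [gelfandReal_saMul] at hQQ'
    refine ⟨1 - gelfandReal Q, by linear_combination hQQ', fun φ hφ => ?_, fun y hy => ?_⟩
    · have hxq : (x : A) * q = 0 := by
        have : q ∈ {y : A | (x : A) * y = 0} := by rw [hann]; exact ⟨1, mul_one q⟩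
        exact this
      have hxQ : saMul x Q = 0 := Subtype.ext hxq
      have h' := congrArg gelfandReal hxQ
      rw [gelfandReal_saMul, map_zero] at h'
      have h0 : gelfandReal x φ * gelfandReal Q φ = 0 := DFunLike.congr_fun h' φ
      simp [(mul_eq_zero.1 h0).resolve_left hφ]
    · obtain ⟨z, rfl⟩ := gelfandReal_surjective y
      rw [← gelfandReal_saMul] at hy
      have hxz : saMul x z = 0 := gelfandReal_injective (by rw [hy, map_zero])
      have hz : (z : A) ∈ {y : A | (x : A) * y = 0} := congrArg Subtype.val hxz
      rw [hann] at hz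
      obtain ⟨w, hw⟩ := hz
      have hqz : saMul Q z = z := by
        refine Subtype.ext ?_
        rw [coe_saMul, ← hw]
        change q * (q * w) = q * w
        rw [← mul_assoc, hq.isIdempotentElem]
      rw [sub_mul, one_mul, ← gelfandReal_saMul, hqz, sub_self]
  · intro h x
    -- A general `x` is replaced by its modulus, which vanishes at the same characters and so has
    -- the same annihilator.
    obtain ⟨p, hpp, hp1, hp2⟩ := h (gelfandReal (saModulus x))
    obtain ⟨q, hq⟩ := gelfandReal_surjective (A := A) (1 - p)
    have hqφ : ∀ φ, φ (q : A) = 1 - (p φ : ℂ) := fun φ => by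
      rw [← ofReal_gelfandReal, hq]
      simp
    have hqq : saMul q q = q := gelfandReal_injective (by
      rw [gelfandReal_saMul, hq]; linear_combination hpp)
    refine ⟨q, ⟨congrArg Subtype.val hqq, isSelfAdjoint_coe q⟩, Set.Subset.antisymm ?_ ?_⟩
    · intro y hy
      have h0 : gelfandReal (saModulus x) * gelfandReal (saModulus y) = 0 := by
        ext φ
        rw [ContinuousMap.mul_apply, gelfandReal_saModulus, gelfandReal_saModulus, ← norm_mul,
          ← map_mul, show x * y = 0 from hy]
        simp
      have h1 := hp2 _ h0
      refine ⟨y, ext_of_characters fun φ => ?_⟩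
      have h2 := DFunLike.congr_fun h1 φ
      rw [ContinuousMap.mul_apply, gelfandReal_saModulus, ContinuousMap.zero_apply, mul_eq_zero,
        norm_eq_zero] at h2
      change φ ((q : A) * y) = φ y
      rw [map_mul, hqφ]
      rcases h2 with h2 | h2
      · simp [h2]
      · simp [h2]
    · rintro _ ⟨z, rfl⟩
      refine ext_of_characters (A := A) fun φ => ?_
      change φ (x * (q * z)) = φ 0
      rw [map_mul, map_mul, hqφ, map_zero]
      by_cases hx : φ x = 0
      · simp [hx]
      · have := hp1 φ (by rw [gelfandReal_saModulus]; exact norm_ne_zero_iff.2 hx)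
        simp [this]

/-- The Gelfand transform as an order isomorphism. -/
noncomputable def gelfandRealOrderIso (A : Type u) [CommCStarAlgebra A] :
    saPart A ≃o C(characterSpace ℂ A, ℝ) where
  toEquiv := gelfandRealEquiv.toEquiv
  map_rel_iff' := Iff.rfl

theorem isRickart_iff_isCountablyAdditiveComplete (A : CommCStarAlgCat.{u}) :
    isRickart A ↔ IsCountablyAdditiveComplete (saPart A) := by
  rw [isRickart_iff_hasSupportProjections]
  exact ⟨fun h => h.isCountablyAdditiveComplete.of_orderIso (gelfandRealOrderIso A).symm,
    fun h => hasSupportProjections_of_isCountablyAdditiveComplete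
      (h.of_orderIso (gelfandRealOrderIso A))⟩

end CommCStarAlgCat

/-! ### The equivalences -/

theorem IsFAlgebraMul.of_orderIso {Y Z : Type u} [Lattice Y] [AddCommGroup Y] [Module ℝ Y]
    [Lattice Z] [AddCommGroup Z] [Module ℝ Z] {m : Z →ₗ[ℝ] Z →ₗ[ℝ] Z} (hm : IsFAlgebraMul m)
    (e : Y ≃ₗ[ℝ] Z) (he : ∀ x y, e x ≤ e y ↔ x ≤ y) :
    IsFAlgebraMul ((m.compl₁₂ e.toLinearMap e.toLinearMap).compr₂ e.symm.toLinearMap) := by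
  let o : Y ≃o Z := ⟨e.toEquiv, fun {x y} => he x y⟩
  have hinf : ∀ x y, e (x ⊓ y) = e x ⊓ e y := o.map_inf
  have h0 : ∀ x, 0 ≤ e x ↔ 0 ≤ x := fun x => by simpa using he 0 x
  refine ⟨fun x y z => ?_, fun x y hx hy => ?_, fun x y z h hz => ?_⟩
  · simp [hm.assoc]
  · rw [← h0] at *
    simpa using hm.nonneg _ _ hx hy
  · apply e.injective
    rw [hinf]
    have := hm.disjoint (e x) (e y) (e z) (by rw [← hinf, h, map_zero]) ((h0 z).2 hz)
    simpa using this

/-! ### Correspondences carried by quasi-inverses. -/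

namespace CommCStarAlgCat

/-- The identity, from the real subspace to the additive subgroup of self-adjoint elements. -/
noncomputable def saPartEquivSelfAdjoint (A : Type u) [CommCStarAlgebra A] :
    saPart A ≃ₗᵢ[ℝ] selfAdjoint A where
  toFun x := ⟨x, x.2⟩
  invFun x := ⟨x, x.2⟩
  left_inv _ := rfl
  right_inv _ := rfl
  map_add' _ _ := rfl
  map_smul' _ _ := rfl
  norm_map' _ := rfl

/-- A quasi-inverse of `toRealMISpace` has the required correspondence. -/
noncomputable def realCorrespondence {F : RealMISpace.{u} ⥤ CommCStarAlgCat.{u}}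
    (η : 𝟭 RealMISpace.{u} ≅ F ⋙ toRealMISpace) : RealCorrespondence F :=
  let e : ∀ X : RealMISpace.{u}, X ≃ₗᵢ[ℝ] saPart (F.obj X) := fun X =>
    RealMISpace.isoToLinearIsometryEquiv (η.app X)
  have he : ∀ X x y, e X x ≤ e X y ↔ x ≤ y := fun X x y =>
    (RealMISpace.isoToOrderIso (η.app X)).le_iff_le
  { iso := fun X => (e X).trans (saPartEquivSelfAdjoint (F.obj X))
    iso_unit := fun X => congrArg Subtype.val (RealMISpace.Hom.map_unit (η.hom.app X))
    nonneg_iff := fun X x => by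
      rw [← he X 0 x, map_zero]
      exact saPart_nonneg_iff (e X x)
    mul := fun X => (saMul.compl₁₂ (e X).toLinearEquiv.toLinearMap
      (e X).toLinearEquiv.toLinearMap).compr₂ (e X).toLinearEquiv.symm.toLinearMap
    isFAlgebraMul := fun X => isFAlgebraMul_saMul.of_orderIso (e X).toLinearEquiv (he X)
    iso_mul := fun X x y => congrArg Subtype.val
      ((e X).toLinearEquiv.apply_symm_apply (saMul (e X x) (e X y)))
    naturality := fun {X Y} f x =>
      congrArg (fun g : X ⟶ toRealMISpace.obj (F.obj Y) =>
        (saPart (F.obj Y)).subtype (RealMISpace.Hom.toLin g x)) (η.hom.naturality f) }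

end CommCStarAlgCat

namespace ComplexMISpace

theorem Hom.norm_le {X Y : ComplexMISpace.{u}} (f : Hom X Y) (x : X) : ‖f.toLin x‖ ≤ ‖x‖ := by
  refine (Y.isLeast_norm _).2 ⟨norm_nonneg x, ?_⟩
  have h1 : Y.modulus (f.toLin x) = mapReal f (X.modulus x) :=
    Subtype.ext (f.map_modulus x).symm
  have h2 : mapReal f X.unit = Y.unit := Subtype.ext f.map_unit
  rw [h1, ← h2, ← map_smul]
  exact RealMISpace.Hom.monotone (toRealMISpace.map (X := X) (Y := Y) f) (X.isLeast_norm x).1.2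

/-- The linear isometry underlying an isomorphism of complex MI-spaces. -/
def isoToLinearIsometryEquiv {X Y : ComplexMISpace.{u}} (i : X ≅ Y) : X ≃ₗᵢ[ℂ] Y where
  toLinearEquiv :=
    { Hom.toLin i.hom with
      invFun := Hom.toLin i.inv
      left_inv := fun x => LinearMap.congr_fun (congrArg Hom.toLin i.hom_inv_id) x
      right_inv := fun x => LinearMap.congr_fun (congrArg Hom.toLin i.inv_hom_id) x }
  norm_map' x := by
    refine le_antisymm (Hom.norm_le i.hom x) ?_
    have h := Hom.norm_le i.inv (Hom.toLin i.hom x)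
    have h' : Hom.toLin i.inv (Hom.toLin i.hom x) = x :=
      LinearMap.congr_fun (congrArg Hom.toLin i.hom_inv_id) x
    rwa [h'] at h

theorem mem_real_iff_of_iso {X Y : ComplexMISpace.{u}} (i : X ≅ Y) (x : X) :
    x ∈ X.real ↔ isoToLinearIsometryEquiv i x ∈ Y.real := by
  refine ⟨fun h => map_mem_real i.hom ⟨x, h⟩, fun h => ?_⟩
  have h' := map_mem_real i.inv ⟨_, h⟩
  have hx : Hom.toLin i.inv (isoToLinearIsometryEquiv i x) = x :=
    (isoToLinearIsometryEquiv i).symm_apply_apply x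
  rwa [hx] at h'

end ComplexMISpace

namespace CommCStarAlgCat

open ComplexMISpace in
/-- A quasi-inverse of `toComplexMISpace` has the required correspondence. -/
noncomputable def complexCorrespondence {F : ComplexMISpace.{u} ⥤ CommCStarAlgCat.{u}}
    (η : 𝟭 ComplexMISpace.{u} ≅ F ⋙ toComplexMISpace) : ComplexCorrespondence F :=
  let e : ∀ X : ComplexMISpace.{u}, X.real ≃ₗ[ℝ] saPart (F.obj X) := fun X =>
    (RealMISpace.isoToLinearIsometryEquiv
      (ComplexMISpace.toRealMISpace.mapIso (η.app X))).toLinearEquiv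
  have he : ∀ X x y, e X x ≤ e X y ↔ x ≤ y := fun X x y =>
    (RealMISpace.isoToOrderIso (ComplexMISpace.toRealMISpace.mapIso (η.app X))).le_iff_le
  { iso := fun X => isoToLinearIsometryEquiv (Y := toComplexMISpace.obj (F.obj X)) (η.app X)
    iso_unit := fun X => ComplexMISpace.Hom.map_unit (η.hom.app X)
    mem_real_iff := fun X x => mem_real_iff_of_iso (Y := toComplexMISpace.obj (F.obj X)) (η.app X) x
    nonneg_iff := fun X x => by
      rw [← he X 0 x, map_zero]
      exact saPart_nonneg_iff (e X x)
    mul := fun X => (saMul.compl₁₂ (e X).toLinearMap (e X).toLinearMap).compr₂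
      (e X).symm.toLinearMap
    isFAlgebraMul := fun X => isFAlgebraMul_saMul.of_orderIso (e X) (he X)
    iso_mul := fun X x y => congrArg Subtype.val
      ((e X).apply_symm_apply (saMul (e X x) (e X y)))
    naturality := fun {X Y} f x =>
      congrArg (fun g : X ⟶ toComplexMISpace.obj (F.obj Y) =>
        (ComplexMISpace.Hom.toLin g x : F.obj Y)) (η.hom.naturality f) }

theorem inverseImage_toRealMISpace :
    RealMISpace.isAbstractLInfty.{u}.inverseImage toRealMISpace = isRickart := by
  ext A
  exact (isRickart_iff_isCountablyAdditiveComplete A).symm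

theorem inverseImage_toComplexMISpace :
    ComplexMISpace.isAbstractLInfty.{u}.inverseImage toComplexMISpace = isRickart := by
  ext A
  exact (isRickart_iff_isCountablyAdditiveComplete A).symm

end CommCStarAlgCat

instance : RealMISpace.isAbstractLInfty.{u}.IsClosedUnderIsomorphisms where
  of_iso i h := IsCountablyAdditiveComplete.of_orderIso (RealMISpace.isoToOrderIso i) h

instance : ComplexMISpace.isAbstractLInfty.{u}.IsClosedUnderIsomorphisms where
  of_iso i h := IsCountablyAdditiveComplete.of_orderIso
    (RealMISpace.isoToOrderIso (ComplexMISpace.toRealMISpace.mapIso i)) h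

theorem mainTheorem7 :
    (∃ (E : RealMISpace.{u} ≌ CommCStarAlgCat.{u}) (E' : RealALInfty.{u} ≌ CommRickartCat.{u}),
      Nonempty (RealCorrespondence E.functor) ∧
      Nonempty (E'.functor ⋙ CommCStarAlgCat.isRickart.{u}.ι ≅
        RealMISpace.isAbstractLInfty.{u}.ι ⋙ E.functor)) ∧
    (∃ (E : ComplexMISpace.{u} ≌ CommCStarAlgCat.{u})
        (E' : ComplexALInfty.{u} ≌ CommRickartCat.{u}),
      Nonempty (ComplexCorrespondence E.functor) ∧
      Nonempty (E'.functor ⋙ CommCStarAlgCat.isRickart.{u}.ι ≅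
        ComplexMISpace.isAbstractLInfty.{u}.ι ⋙ E.functor)) := by
  -- The maps `φ_X` are the components of the inverse counit. `E'` is induced by `E` on full
  -- subcategories, so the two composites agree by definition and the identity isomorphism suffices.
  refine ⟨⟨CommCStarAlgCat.toRealMISpace.asEquivalence.symm,
    (CommCStarAlgCat.toRealMISpace.asEquivalence.congrFullSubcategory
      CommCStarAlgCat.inverseImage_toRealMISpace).symm,
    ⟨CommCStarAlgCat.realCorrespondence
      CommCStarAlgCat.toRealMISpace.asEquivalence.counitIso.symm⟩, ⟨Iso.refl _⟩⟩,
    ⟨CommCStarAlgCat.toComplexMISpace.asEquivalence.symm,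
    (CommCStarAlgCat.toComplexMISpace.asEquivalence.congrFullSubcategory
      CommCStarAlgCat.inverseImage_toComplexMISpace).symm,
    ⟨CommCStarAlgCat.complexCorrespondence
      CommCStarAlgCat.toComplexMISpace.asEquivalence.counitIso.symm⟩, ⟨Iso.refl _⟩⟩⟩
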